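/- Fix $n\in\mathbb N$. A (sub)-Riemannian structure $(M,\mathcal D,g)$ is a smooth connected $n$-dimensional manifold $M$ with a smooth bracket-generating distribution $\mathcal D\subseteq TM$ of constant rank $k\le n$ and a smooth scalar product $g$ on $\mathcal D$. All structures are assumed oriented and equiregular: with $\mathcal D^1=\mathcal D$ and $\mathcal D^{i+1}=\mathcal D^i+[\mathcal D^i,\mathcal D]$, the dimension of $\mathcal D^i_q$ does not depend on $q$. An isometry is a diffeomorphism whose differential maps $\mathcal D_M$ onto $\mathcal D_N$ and preserves the scalar products. The nilpotent approximation $\hat M_q$ of $M$ at $q$ is the connected, simply connected Lie group with unit $0$ and with Lie algebra $\mathcal D_q\oplus\mathcal D^2_q/\mathcal D_q\oplus\dots\oplus\mathcal D^m_q/\mathcal D^{m-1}_q$, whose bracket is induced by the bracket of vector fields ($[X_q,Y_q]=[X,Y]_q \bmod \mathcal D^{i+j-1}_q$ for sections $X$ of $\mathcal D^i$ and $Y$ of $\mathcal D^j$), with the left-invariant (sub)-Riemannian structure that extends $(\mathcal D_q,g_q)$. Sending an adapted basis of $T_qM$ to its classes induces a canonical isomorphism $\theta_q:\bigwedge^nT_qM\to\bigwedge^n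 T_0\hat M_q$, through which $\hat M_q$ is oriented; $\theta_q^*$ denotes the dual map from top-degree forms on $T_0\hat M_q$ to top-degree forms on $T_qM$. An intrinsic definition of volume is a map $\omega$ that associates with every such structure $M$ a smooth positive volume form $\omega_M$ such that $\phi^*\omega_N=\omega_M$ for every orientation-preserving isometry $\phi:M\to N$. It is orientation-independent if moreover $\phi^*\omega_N=-\omega_M$ for every orientation-reversing isometry $\phi:M\to N$. It is N-intrinsic if $\omega_M(q)=\theta_q^*\big(\omega_{\hat M_q}(0)\big)$ for all $M$ and $q\in M$. A structure is equi-nilpotentizable if $\hat M_p$ and $\hat M_q$ are isometric for all $p,q\in M$. Popp's volume $\mathcal P_M$ is the volume form with $\mathcal P_M(q)=\theta_q^*\mu_q$, where $\mu_q$ is the positive Euclidean volume form of the orthogonal direct sum $\bigoplus_i\mathcal D^i_q/\mathcal D^{i-1}_q$, the scalar product of $\mathcal D^i_q/\mathcal D^{i-1}_q$ being induced by the surjection $\pi_i:\bigotimes^i\mathcal D_q\to\mathcal D^i_q/\mathcal D^{i-1}_q$, $\pi_i(v_1\otimes\dots\otimes v_i)=[V_1,[V_2,\dots,[V_{i-1},V_i]]]_q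 \bmod \mathcal D^{i-1}_q$ (with horizontal extensions $V_j$ of $v_j$), that is $\|v\|=\min\{\|e\|:\pi_i(e)=v\}$. Theorem. Let $\omega$ and $\omega'$ be two N-intrinsic definitions of volume. Then there are functions $c_M:M\to\mathbb R$, one for each structure $M$, such that: 1. for every $M$, $c_M$ is smooth and $\omega_M=c_M\,\omega'_M$; 2. $c_M(q)$ depends only on the isometry class of the nilpotent approximation at $q$: if there is an orientation-preserving isometry $\hat M_q\to\hat N_p$, then $c_M(q)=c_N(p)$; if $\omega$ and $\omega'$ are orientation-independent, then $c_M(q)=c_N(p)$ as soon as there is any isometry $\hat M_q\to\hat N_p$; 3. if $M$ is equi-nilpotentizable, then $\omega_M$ is a constant multiple of $\omega'_M$ and a constant multiple of Popp's volume $\mathcal P_M$. -/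

import Mathlib

open scoped Manifold ContDiff Topology DirectSum
open VectorField

noncomputable section

/-! ### Smooth vector fields and the flag of a distribution -/

section Flag

variable {n : ℕ} {M : Type} [TopologicalSpace M] [ChartedSpace (EuclideanSpace ℝ (Fin n)) M]

/-- A (possibly non-smooth) vector field on `M`. -/
abbrev VField (n : ℕ) (M : Type) [TopologicalSpace M]
    [ChartedSpace (EuclideanSpace ℝ (Fin n)) M] : Type :=
  ∀ x : M, TangentSpace (𝓡 n) x

variable [IsManifold (𝓡 n) ∞ M]

/-- Smoothness of a vector field, as a section of the tangent bundle. -/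
def SmoothField (X : VField n M) : Prop :=
  ContMDiff (𝓡 n) (𝓡 n).tangent ∞ (fun x => (⟨x, X x⟩ : TangentBundle (𝓡 n) M))

/-- A field of (pointwise, possibly non-smooth) top-degree exterior forms on `M`. -/
abbrev TopForm (n : ℕ) (M : Type) [TopologicalSpace M]
    [ChartedSpace (EuclideanSpace ℝ (Fin n)) M] : Type :=
  ∀ x : M, (TangentSpace (𝓡 n) x) [⋀^Fin n]→ₗ[ℝ] ℝ

/-- Smoothness of a top-degree form, tested on smooth vector fields. -/
def SmoothForm (μ : TopForm n M) : Prop :=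
  ∀ X : Fin n → VField n M, (∀ i, SmoothField (X i)) →
    ContMDiff (𝓡 n) 𝓘(ℝ) ∞ (fun x => μ x (fun i => X i x))

/-- `Γ(D)`: the smooth sections of the distribution `D` (horizontal vector fields). -/
def horizontalFields (D : ∀ x : M, Submodule ℝ (TangentSpace (𝓡 n) x)) :
    Submodule ℝ (VField n M) where
  carrier := {X | SmoothField X ∧ ∀ x, X x ∈ D x}
  add_mem' := fun hX hY => ⟨hX.1.add_section hY.1, fun x => (D x).add_mem (hX.2 x) (hY.2 x)⟩
  zero_mem' := ⟨Bundle.contMDiff_zeroSection ℝ _, fun x => (D x).zero_mem⟩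
  smul_mem' := fun c _ hX =>
    ⟨ContMDiff.const_smul_section hX.1, fun x => (D x).smul_mem c (hX.2 x)⟩

/-- The modules of vector fields `D⁰ = 0`, `D¹ = Γ(D)`, `Dⁱ⁺¹ = Dⁱ + [Dⁱ, D]`. -/
def flagFields (D : ∀ x : M, Submodule ℝ (TangentSpace (𝓡 n) x)) : ℕ → Submodule ℝ (VField n M)
  | 0 => ⊥
  | 1 => horizontalFields D
  | i + 2 => flagFields D (i + 1) ⊔ Submodule.span ℝ
      {Z | ∃ X ∈ flagFields D (i + 1), ∃ Y ∈ horizontalFields D, Z = mlieBracket (𝓡 n) X Y}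

/-- The flag `0 = D⁰_q ⊆ D¹_q ⊆ D²_q ⊆ …` of subspaces of the tangent space at `q`. -/
def flag (D : ∀ x : M, Submodule ℝ (TangentSpace (𝓡 n) x)) (i : ℕ) (q : M) :
    Submodule ℝ (TangentSpace (𝓡 n) q) :=
  (flagFields D i).map (LinearMap.proj q)

variable {D : ∀ x : M, Submodule ℝ (TangentSpace (𝓡 n) x)}

theorem mem_flag_of_mem_flagFields {i : ℕ} {X : VField n M} (hX : X ∈ flagFields D i) (q : M) :
    X q ∈ flag D i q :=
  ⟨X, hX, rfl⟩

theorem SmoothField.mlieBracket {X Y : VField n M} (hX : SmoothField X) (hY : SmoothField Y) :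
    SmoothField (mlieBracket (𝓡 n) X Y) := by
  have : IsManifold (𝓡 n) (((⊤ : ℕ∞) : WithTop ℕ∞) + 1) M := by
    simpa using (inferInstance : IsManifold (𝓡 n) ∞ M)
  have : IsManifold (𝓡 n) (minSmoothness ℝ 2) M := by
    rw [minSmoothness_of_isRCLikeNormedField]; infer_instance
  exact ContDiff.mlieBracket_vectorField (m := ⊤) (n := ⊤) hX hY
    (by rw [minSmoothness_of_isRCLikeNormedField]; simp)

theorem smoothField_of_mem_flagFields : ∀ {i : ℕ} {X : VField n M}, X ∈ flagFields D i →
    SmoothField X := by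
  have key : ∀ (S : Submodule ℝ (VField n M)), (∀ X ∈ S, SmoothField X) ↔
      S ≤ horizontalFields (fun x : M => (⊤ : Submodule ℝ (TangentSpace (𝓡 n) x))) :=
    fun S => ⟨fun h X hX => ⟨h X hX, fun _ => trivial⟩, fun h X hX => (h hX).1⟩
  intro i
  suffices h : ∀ X ∈ flagFields D i, SmoothField X from fun {X} hX => h X hX
  induction i using Nat.twoStepInduction with
  | zero => exact (key _).2 bot_le
  | one => exact fun X hX => hX.1
  | more i _ ih =>
    refine (key _).2 (sup_le ((key _).1 ih) (Submodule.span_le.2 ?_))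
    rintro Z ⟨X, hX, Y, hY, rfl⟩
    exact ⟨(ih X hX).mlieBracket hY.1, fun _ => trivial⟩

theorem flagFields_le_succ (i : ℕ) : flagFields D i ≤ flagFields D (i + 1) := by
  cases i with
  | zero => exact bot_le
  | succ i => exact le_sup_left

theorem SmoothField.mdifferentiableAt {X : VField n M} (hX : SmoothField X) (x : M) :
    MDifferentiableAt (𝓡 n) (𝓡 n).tangent (fun x => (⟨x, X x⟩ : TangentBundle (𝓡 n) M)) x :=
  (hX x).mdifferentiableAt (by simp)

/-- `[Dⁱ, Dʲ] ⊆ Dⁱ⁺ʲ` at the level of sections. -/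
theorem mlieBracket_mem_flagFields {j : ℕ} : ∀ {i : ℕ} {X Y : VField n M},
    X ∈ flagFields D i → Y ∈ flagFields D j → mlieBracket (𝓡 n) X Y ∈ flagFields D (i + j) := by
  have base : ∀ {i : ℕ} {X Y : VField n M}, X ∈ flagFields D i → Y ∈ horizontalFields D →
      mlieBracket (𝓡 n) X Y ∈ flagFields D (i + 1) := by
    intro i X Y hX hY
    cases i with
    | zero =>
      rw [(Submodule.mem_bot ℝ).1 hX, mlieBracket_zero_left]
      exact Submodule.zero_mem _
    | succ i => exact Submodule.mem_sup_right (Submodule.subset_span ⟨X, hX, Y, hY, rfl⟩)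
  induction j using Nat.twoStepInduction with
  | zero =>
    intro i X Y _ hY
    rw [(Submodule.mem_bot ℝ).1 hY, mlieBracket_zero_right]
    exact Submodule.zero_mem _
  | one => exact base
  | more j _ ih =>
    intro i X Y hX hY
    have hXs := smoothField_of_mem_flagFields hX
    -- brackets with `X` that land in the right place form a submodule
    have hle : flagFields D (j + 2) ≤
        { carrier := {Y | SmoothField Y ∧
            mlieBracket (𝓡 n) X Y ∈ flagFields D (i + (j + 2))}
          add_mem' := fun {Y Z} hY hZ => ⟨hY.1.add_section hZ.1, by
            have : mlieBracket (𝓡 n) X (Y + Z) =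
                mlieBracket (𝓡 n) X Y + mlieBracket (𝓡 n) X Z :=
              funext fun x => mlieBracket_add_right (hY.1.mdifferentiableAt x)
                (hZ.1.mdifferentiableAt x)
            rw [this]
            exact Submodule.add_mem _ hY.2 hZ.2⟩
          zero_mem' := ⟨Bundle.contMDiff_zeroSection ℝ _, by
            rw [mlieBracket_zero_right]; exact Submodule.zero_mem _⟩
          smul_mem' := fun c Y hY => ⟨ContMDiff.const_smul_section hY.1, by
            have : mlieBracket (𝓡 n) X (c • Y) = c • mlieBracket (𝓡 n) X Y :=
              funext fun x => mlieBracket_const_smul_right (hY.1.mdifferentiableAt x)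
            rw [this]
            exact Submodule.smul_mem _ c hY.2⟩ : Submodule ℝ (VField n M) } := by
      refine sup_le (fun Y hY => ⟨smoothField_of_mem_flagFields hY, ?_⟩) (Submodule.span_le.2 ?_)
      · exact flagFields_le_succ (i + (j + 1)) (ih hX hY)
      · rintro Z ⟨Y, hY, W, hW, rfl⟩
        have hYs := smoothField_of_mem_flagFields hY
        refine ⟨hYs.mlieBracket hW.1, ?_⟩
        have le2 : minSmoothness ℝ 2 ≤ ((⊤ : ℕ∞) : WithTop ℕ∞) := by
          rw [minSmoothness_of_isRCLikeNormedField]; exact WithTop.coe_le_coe.2 (le_top : (2 : ℕ∞) ≤ ⊤)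
        have : IsManifold (𝓡 n) (minSmoothness ℝ 3) M := by
          rw [minSmoothness_of_isRCLikeNormedField]; infer_instance
        rw [leibniz_identity_mlieBracket (hXs.of_le le2) (hYs.of_le le2)
          (ContMDiff.of_le hW.1 le2)]
        refine Submodule.add_mem _ (base (ih hX hY) hW) ?_
        rw [mlieBracket_swap]
        refine Submodule.neg_mem _ ?_
        have := ih (base hX hW) hY
        rwa [show i + 1 + (j + 1) = i + (j + 2) by omega] at this
    exact (hle hY).2

end Flag

/-! ### (Sub)-Riemannian structures -/

/-- A `n`-dimensional (sub)-Riemannian structure `(M, D, g)`: a smooth connected manifold `M`, a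
smooth bracket-generating distribution `D` of constant rank `k ≤ n` and a smooth scalar product `g`
on `D`. The Riemannian case is `D = TM`. Vector fields and frames are taken globally defined and
smooth; by multiplication with cut-off functions this is the same as using local ones. -/
structure SubRiemannian (n : ℕ) where
  carrier : Type
  [top : TopologicalSpace carrier]
  [charted : ChartedSpace (EuclideanSpace ℝ (Fin n)) carrier]
  [manifold : IsManifold (𝓡 n) ∞ carrier]
  [t2 : T2Space carrier]
  [secondCountable : SecondCountableTopology carrier]
  [connected : ConnectedSpace carrier]
  /-- The rank `k` of the distribution. -/
  rank : ℕ
  /-- The distribution. -/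
  dist : ∀ q : carrier, Submodule ℝ (TangentSpace (𝓡 n) q)
  /-- The scalar product on the distribution. -/
  metric : ∀ q : carrier, LinearMap.BilinForm ℝ (dist q)
  /-- Around every point, `D` is spanned by `k` smooth linearly independent vector fields. -/
  exists_frame : ∀ q : carrier, ∃ X : Fin rank → VField n carrier,
    (∀ i, X i ∈ horizontalFields dist) ∧
    ∀ᶠ x in 𝓝 q, LinearIndependent ℝ (fun i => X i x) ∧
      Submodule.span ℝ (Set.range fun i => X i x) = dist x
  metric_symm : ∀ q v w, metric q v w = metric q w v
  metric_pos : ∀ q v, v ≠ 0 → 0 < metric q v v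
  metric_smooth : ∀ X Y : horizontalFields dist, ContMDiff (𝓡 n) 𝓘(ℝ) ∞
    (fun q => metric q ⟨X.1 q, X.2.2 q⟩ ⟨Y.1 q, Y.2.2 q⟩)
  /-- Hörmander's condition. -/
  bracket_generating : ∀ q, ∃ m, flag dist m q = ⊤

attribute [instance] SubRiemannian.top SubRiemannian.charted SubRiemannian.manifold
  SubRiemannian.t2 SubRiemannian.secondCountable SubRiemannian.connected

/-- The top-degree form `α` is positive for the orientation `o`. -/
def IsPositiveForm {n : ℕ} {V : Type} [AddCommGroup V] [Module ℝ V] (o : Orientation ℝ V (Fin n))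
    (α : V [⋀^Fin n]→ₗ[ℝ] ℝ) : Prop :=
  ∃ h : α ≠ 0, rayOfNeZero ℝ α h = o

/-- An oriented equiregular (sub)-Riemannian structure. -/
structure OrientedStructure (n : ℕ) extends SubRiemannian n where
  /-- The dimension of `Dⁱ_q` does not depend on `q`. -/
  equiregular : ∀ (i : ℕ) (p q : carrier),
    Module.finrank ℝ (flag dist i p) = Module.finrank ℝ (flag dist i q)
  /-- The orientation of the tangent spaces. -/
  orientation : ∀ q : carrier, Orientation ℝ (TangentSpace (𝓡 n) q) (Fin n)
  /-- The orientation is the one of a smooth nowhere vanishing top-degree form. -/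
  exists_orientation_form : ∃ μ : TopForm n carrier,
    SmoothForm μ ∧ ∀ q, IsPositiveForm (orientation q) (μ q)

namespace OrientedStructure

variable {n : ℕ}

/-- The flag of subspaces `Dⁱ_q` of `T_qM`. -/
abbrev flagAt (M : OrientedStructure n) (i : ℕ) (q : M.carrier) :
    Submodule ℝ (TangentSpace (𝓡 n) q) :=
  flag M.dist i q

/-- The module of horizontal vector fields. -/
abbrev horizontal (M : OrientedStructure n) : Submodule ℝ (VField n M.carrier) :=
  horizontalFields M.dist

/-- The scalar product at `q` of the values of two horizontal vector fields. -/
def innerAt (M : OrientedStructure n) (q : M.carrier) (X Y : M.horizontal) : ℝ :=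
  M.metric q ⟨X.1 q, X.2.2 q⟩ ⟨Y.1 q, Y.2.2 q⟩

/-! ### Isometries -/

/-- A diffeomorphism is an isometry if its differential maps the distribution onto the distribution
and preserves the scalar product. -/
structure IsIsometry (M N : OrientedStructure n)
    (φ : M.carrier ≃ₘ^∞⟮𝓡 n, 𝓡 n⟯ N.carrier) : Prop where
  map_dist : ∀ q, (M.dist q).map (mfderiv (𝓡 n) (𝓡 n) φ q).toLinearMap = N.dist (φ q)
  map_metric : ∀ q (v w : M.dist q) (v' w' : N.dist (φ q)),
    (v' : TangentSpace (𝓡 n) (φ q)) = mfderiv (𝓡 n) (𝓡 n) φ q v →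
    (w' : TangentSpace (𝓡 n) (φ q)) = mfderiv (𝓡 n) (𝓡 n) φ q w →
    N.metric (φ q) v' w' = M.metric q v w

/-- The pull-back `φ^* β` of a top-degree form. -/
def pullbackForm {M N : OrientedStructure n} (φ : M.carrier ≃ₘ^∞⟮𝓡 n, 𝓡 n⟯ N.carrier)
    (β : TopForm n N.carrier) : TopForm n M.carrier :=
  fun q => (β (φ q)).compLinearMap (mfderiv (𝓡 n) (𝓡 n) φ q).toLinearMap

/-- `φ` preserves the orientations. -/
def PreservesOrientation {M N : OrientedStructure n}
    (φ : M.carrier ≃ₘ^∞⟮𝓡 n, 𝓡 n⟯ N.carrier) : Prop :=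
  ∀ β : TopForm n N.carrier, (∀ p, IsPositiveForm (N.orientation p) (β p)) →
    ∀ q, IsPositiveForm (M.orientation q) (pullbackForm φ β q)

/-- `φ` reverses the orientations. -/
def ReversesOrientation {M N : OrientedStructure n}
    (φ : M.carrier ≃ₘ^∞⟮𝓡 n, 𝓡 n⟯ N.carrier) : Prop :=
  ∀ β : TopForm n N.carrier, (∀ p, IsPositiveForm (N.orientation p) (β p)) →
    ∀ q, IsPositiveForm (-M.orientation q) (pullbackForm φ β q)

/-! ### The nilpotentization and the nilpotent approximation -/

/-- The nilpotentization `M̂_q = ⨁ᵢ Dⁱ_q / Dⁱ⁻¹_q`, graded by the weight `i` (the component of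
weight `0` is trivial). -/
abbrev Nilpotentization (M : OrientedStructure n) (q : M.carrier) : Type :=
  ⨁ i : ℕ, (M.flagAt i q ⧸ (M.flagAt (i - 1) q).submoduleOf (M.flagAt i q))

/-- The class in `Dⁱ_q / Dⁱ⁻¹_q ⊆ M̂_q` of a vector of `Dⁱ_q`. -/
def grClass (M : OrientedStructure n) (q : M.carrier) (i : ℕ) :
    M.flagAt i q →ₗ[ℝ] M.Nilpotentization q :=
  DirectSum.lof ℝ ℕ
    (fun i => M.flagAt i q ⧸ (M.flagAt (i - 1) q).submoduleOf (M.flagAt i q)) i ∘ₗ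
  ((M.flagAt (i - 1) q).submoduleOf (M.flagAt i q)).mkQ

/-- The class in `Dⁱ_q / Dⁱ⁻¹_q ⊆ M̂_q` of the value at `q` of a section of `Dⁱ`. -/
def symbol (M : OrientedStructure n) (q : M.carrier) (i : ℕ) (X : VField n M.carrier)
    (hX : X ∈ flagFields M.dist i) : M.Nilpotentization q :=
  M.grClass q i ⟨X q, mem_flag_of_mem_flagFields hX q⟩

/-- A basis of `T_qM` adapted to the flag: the vector `b j` has weight `w j`, and the vectors of
weight at most `i` span `Dⁱ_q`. -/
structure IsAdapted (M : OrientedStructure n) (q : M.carrier)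
    (b : Module.Basis (Fin n) ℝ (TangentSpace (𝓡 n) q)) (w : Fin n → ℕ) : Prop where
  mem : ∀ j, b j ∈ M.flagAt (w j) q
  span : ∀ i, Submodule.span ℝ (b '' {j | w j ≤ i}) = M.flagAt i q

/-- The linear map `θ̂ : T_qM → M̂_q` of an adapted basis, which sends each vector of the basis to
its class. Its action on top-degree multivectors is the canonical map
`θ_q : ⋀ⁿ T_qM → ⋀ⁿ M̂_q`, which does not depend on the adapted basis. -/
def thetaHat (M : OrientedStructure n) {q : M.carrier}
    {b : Module.Basis (Fin n) ℝ (TangentSpace (𝓡 n) q)} {w : Fin n → ℕ} (h : M.IsAdapted q b w) :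
    TangentSpace (𝓡 n) q →ₗ[ℝ] M.Nilpotentization q :=
  b.constr ℝ (fun j => M.grClass q (w j) ⟨b j, h.mem j⟩)

/-- A realization of the nilpotent approximation of `M` at `q`: a connected, simply connected Lie
group `G` whose Lie algebra is identified with `M̂_q` with the bracket
`[X_q, Y_q] = [X, Y]_q mod Dⁱ⁺ʲ⁻¹_q` for sections `X` of `Dⁱ` and `Y` of `Dʲ`, with the
left-invariant (sub)-Riemannian structure obtained from `D_q` and `g_q`. It is oriented through the
canonical identification `θ_q`. Such a realization exists, and it is unique up to isometries that
preserve orientation and unit element. -/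
structure NilpotentApproximation (M : OrientedStructure n) (q : M.carrier) where
  /-- The left-invariant structure. -/
  space : OrientedStructure n
  [group : Group space.carrier]
  [lieGroup : LieGroup (𝓡 n) ∞ space.carrier]
  [simplyConnected : SimplyConnectedSpace space.carrier]
  /-- The identification of `M̂_q` with the Lie algebra of the group. -/
  toLie : M.Nilpotentization q ≃ₗ[ℝ] GroupLieAlgebra (𝓡 n) space.carrier
  toLie_bracket : ∀ (i j : ℕ) (X Y : VField n M.carrier)
    (hX : X ∈ flagFields M.dist i) (hY : Y ∈ flagFields M.dist j),
    toLie (M.symbol q (i + j) (mlieBracket (𝓡 n) X Y) (mlieBracket_mem_flagFields hX hY)) =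
      ⁅toLie (M.symbol q i X hX), toLie (M.symbol q j Y hY)⁆
  /-- The distribution is spanned by the left-invariant fields with values in `D_q` at the unit. -/
  dist_eq : ∀ (x : space.carrier) (u : TangentSpace (𝓡 n) x), u ∈ space.dist x ↔
    ∃ X : M.horizontal, u = mulInvariantVectorField (toLie (M.symbol q 1 X.1 X.2)) x
  /-- The scalar product is the left-invariant extension of `g_q`. -/
  metric_eq : ∀ (x : space.carrier) (X Y : M.horizontal) (u v : space.dist x),
    (u : TangentSpace (𝓡 n) x) = mulInvariantVectorField (toLie (M.symbol q 1 X.1 X.2)) x →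
    (v : TangentSpace (𝓡 n) x) = mulInvariantVectorField (toLie (M.symbol q 1 Y.1 Y.2)) x →
    space.metric x u v = M.innerAt q X Y
  orientation_eq : ∀ (b : Module.Basis (Fin n) ℝ (TangentSpace (𝓡 n) q)) (w : Fin n → ℕ)
    (h : M.IsAdapted q b w)
    (α : (GroupLieAlgebra (𝓡 n) space.carrier) [⋀^Fin n]→ₗ[ℝ] ℝ),
    IsPositiveForm (space.orientation 1) α →
      IsPositiveForm (M.orientation q) (α.compLinearMap (toLie.toLinearMap ∘ₗ M.thetaHat h))

attribute [instance] NilpotentApproximation.group NilpotentApproximation.lieGroup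
  NilpotentApproximation.simplyConnected

/-- The nilpotent approximations of `M` at `q` and of `N` at `p` are isometric. -/
def NilpotentIsometric (M : OrientedStructure n) (q : M.carrier)
    (N : OrientedStructure n) (p : N.carrier) : Prop :=
  ∃ (A : M.NilpotentApproximation q) (B : N.NilpotentApproximation p)
    (φ : A.space.carrier ≃ₘ^∞⟮𝓡 n, 𝓡 n⟯ B.space.carrier), IsIsometry A.space B.space φ

/-- The nilpotent approximations of `M` at `q` and of `N` at `p` are isometric through an isometry
that preserves the orientations. -/
def OrientedNilpotentIsometric (M : OrientedStructure n) (q : M.carrier)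
    (N : OrientedStructure n) (p : N.carrier) : Prop :=
  ∃ (A : M.NilpotentApproximation q) (B : N.NilpotentApproximation p)
    (φ : A.space.carrier ≃ₘ^∞⟮𝓡 n, 𝓡 n⟯ B.space.carrier),
    IsIsometry A.space B.space φ ∧ PreservesOrientation φ

/-- All the nilpotent approximations of `M` are isometric. -/
def EquiNilpotentizable (M : OrientedStructure n) : Prop :=
  ∀ p q : M.carrier, NilpotentIsometric M p M q

/-! ### Popp's volume -/

/-- The iterated bracket `[V₁, [V₂, …, [Vᵢ₋₁, Vᵢ]]]` of a list of vector fields. -/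
def nestedBracket {M : Type} [TopologicalSpace M] [ChartedSpace (EuclideanSpace ℝ (Fin n)) M] :
    List (VField n M) → VField n M
  | [] => 0
  | [X] => X
  | X :: Y :: l => mlieBracket (𝓡 n) X (nestedBracket (Y :: l))

/-- The square of the norm of the class of `v` in `Dⁱ_q / Dⁱ⁻¹_q`, that is the least square norm of
the tensors of `⊗ⁱ D_q` that are mapped to this class by
`πᵢ(v₁ ⊗ … ⊗ vᵢ) = [V₁, [V₂, …, Vᵢ]]_q mod Dⁱ⁻¹_q`. A tensor is written as
`∑ a_I e_{I₁} ⊗ … ⊗ e_{Iᵢ}` for an orthonormal basis `e` of `D_q`, with horizontal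
extensions `E` of `e`; its square norm is `∑ a_I ^ 2`. -/
def poppNormSq (M : OrientedStructure n) (q : M.carrier) (i : ℕ) (v : TangentSpace (𝓡 n) q) : ℝ :=
  sInf {s | ∃ (E : Fin M.rank → M.horizontal) (a : (Fin i → Fin M.rank) → ℝ),
    (∀ j l, M.innerAt q (E j) (E l) = if j = l then 1 else 0) ∧
    v - ∑ I, a I • nestedBracket (List.ofFn fun l => (E (I l)).1) q ∈ M.flagAt (i - 1) q ∧
    s = ∑ I, a I ^ 2}

/-- An adapted basis of `T_qM` whose classes form an orthonormal basis of `M̂_q`, which is the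
orthogonal direct sum of the Euclidean spaces `Dⁱ_q / Dⁱ⁻¹_q`. -/
def IsPoppBasis (M : OrientedStructure n) (q : M.carrier)
    (b : Module.Basis (Fin n) ℝ (TangentSpace (𝓡 n) q)) : Prop :=
  ∃ w : Fin n → ℕ, M.IsAdapted q b w ∧ ∀ (i : ℕ) (t : Fin n → ℝ),
    M.poppNormSq q i (∑ j with w j = i, t j • b j) = ∑ j with w j = i, t j ^ 2

open Classical in
/-- Popp's volume form: at each point, the positive form with value `±1` on the bases
of `T_qM` that are adapted with orthonormal classes. -/
def popp (M : OrientedStructure n) : TopForm n M.carrier := fun q =>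
  if h : ∃ b, M.IsPoppBasis q b then
    if IsPositiveForm (M.orientation q) h.choose.det then h.choose.det else -h.choose.det
  else 0

end OrientedStructure

/-! ### Intrinsic definitions of volume -/

open OrientedStructure

/-- An intrinsic definition of volume (in dimension `n`): a map that associates with every oriented
equiregular (sub)-Riemannian structure `M` a volume form `ω_M` (a smooth positive top-degree form)
such that `φ^* ω_N = ω_M` for every orientation-preserving isometry `φ : M → N`. -/
structure IntrinsicVolume (n : ℕ) where
  form : ∀ M : OrientedStructure n, TopForm n M.carrier
  smooth : ∀ M, SmoothForm (form M)
  positive : ∀ M q, IsPositiveForm (M.orientation q) (form M q)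
  invariant : ∀ (M N : OrientedStructure n) (φ : M.carrier ≃ₘ^∞⟮𝓡 n, 𝓡 n⟯ N.carrier),
    IsIsometry M N φ → PreservesOrientation φ → pullbackForm φ (form N) = form M

namespace IntrinsicVolume

variable {n : ℕ}

/-- `vol` does not depend on the orientation up to sign: orientation-reversing isometries change
the sign of the volume form, so that all isometries preserve the induced measure. -/
def OrientationIndependent (vol : IntrinsicVolume n) : Prop :=
  ∀ (M N : OrientedStructure n) (φ : M.carrier ≃ₘ^∞⟮𝓡 n, 𝓡 n⟯ N.carrier),
    IsIsometry M N φ → ReversesOrientation φ → pullbackForm φ (vol.form N) = -vol.form M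

/-- `vol` is N-intrinsic: `ω_M(q) = θ_q^* (ω_{M̂_q}(0))`, where `0` is the unit of the group `M̂_q`. -/
def IsNIntrinsic (vol : IntrinsicVolume n) : Prop :=
  ∀ (M : OrientedStructure n) (q : M.carrier) (A : M.NilpotentApproximation q)
    (b : Module.Basis (Fin n) ℝ (TangentSpace (𝓡 n) q)) (w : Fin n → ℕ) (h : M.IsAdapted q b w),
    vol.form M q = (vol.form A.space 1).compLinearMap (A.toLie.toLinearMap ∘ₗ M.thetaHat h)

end IntrinsicVolume

end

/-! Top-degree forms at a point form a line, so `c_M` can only be the ratio of the two volume forms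
(`density`). It is smooth because near any point it can be evaluated on smooth vector fields.
N-intrinsic volumes at `q` are both pulled back from the unit of the nilpotent approximation by the
same linear map, so the ratio at `q` is the ratio at that unit (`density_eq_space`).
Orientation-preserving isometries preserve the ratio. Left translations of the nilpotent
approximation are such isometries, so the ratio is constant on the group (`density_space_eq`), and
it does not matter where an isometry of nilpotent approximations sends the unit. An
orientation-reversing isometry becomes orientation-preserving once one of the two orientations is
flipped; for orientation-independent volumes the flip changes both signs and leaves the ratio alone.

On an equi-nilpotentizable structure the volumes need not be orientation-independent. The isometries
from all points to a fixed one then allow two values of the ratio, one for each orientation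
character; a continuous function on a connected space with finitely many values is constant.

Popp's form is compared pointwise, through the numbers `|ω_M(q)(b)|` for Popp bases `b`. They do not
depend on `b`, because two Popp bases differ by a block triangular matrix with orthogonal diagonal
blocks (`AdaptedBasis.abs_det_eq_one`). Popp bases pass from `T_qM` to the Lie algebra of the
nilpotent approximation. This rests on two facts: the flag of the left-invariant structure at the
unit is the weight filtration (`flag_space_one`), and iterated brackets of horizontal fields agree
there with iterated Lie brackets modulo lower weight (`nestedBracket_sub_nestedLie_mem`), so that
Popp's norms coincide (`poppNormSq_space_eq`). Popp bases exist because iterated brackets of `D_q`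
fill each graded piece (`range_tensorMap`). The orientation-reversing case is settled by comparing
`ω` with the volume `IntrinsicVolume.opposite`. -/

noncomputable section

/-! ### Bases adapted to a flag -/

section AdaptedBasis

variable {V : Type*} [AddCommGroup V] [Module ℝ V] {n : ℕ}

/-- A basis adapted to an increasing sequence of subspaces, with the weights of its vectors. -/
structure AdaptedBasis (F : ℕ → Submodule ℝ V) (b : Module.Basis (Fin n) ℝ V) (w : Fin n → ℕ) :
    Prop where
  mem : ∀ j, b j ∈ F (w j)
  span : ∀ i, Submodule.span ℝ (b '' {j | w j ≤ i}) = F i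

/-- Bases of the successive subspaces are obtained by extending one another. The weight of a vector
is the stage at which it first appears. -/
theorem exists_adaptedBasis [FiniteDimensional ℝ V] {F : ℕ → Submodule ℝ V} (hF : Monotone F)
    (h0 : F 0 = ⊥) {m : ℕ} (hm : F m = ⊤) (hn : Module.finrank ℝ V = n) :
    ∃ (b : Module.Basis (Fin n) ℝ V) (w : Fin n → ℕ), AdaptedBasis F b w := by
  have step : ∀ (i : ℕ) (s : Set V), LinearIndepOn ℝ id s ∧ Submodule.span ℝ s = F i →
      ∃ s' : Set V, s ⊆ s' ∧ LinearIndepOn ℝ id s' ∧ Submodule.span ℝ s' = F (i + 1) := by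
    rintro i s ⟨h1, h2⟩
    have hst : s ⊆ (F (i + 1) : Set V) := fun x hx =>
      hF (Nat.le_succ i) (h2 ▸ Submodule.subset_span hx)
    obtain ⟨s', h3, h4, h5, h6⟩ := exists_linearIndepOn_id_extension h1 hst
    exact ⟨s', h4, h6, le_antisymm (Submodule.span_le.2 h3) h5⟩
  choose! f hf using step
  obtain ⟨s, hsz, hss⟩ : ∃ s : ℕ → Set V, s 0 = ∅ ∧ ∀ i, s (i + 1) = f i (s i) :=
    ⟨fun i => Nat.rec ∅ (fun i t => f i t) i, rfl, fun _ => rfl⟩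
  have hs : ∀ i, LinearIndepOn ℝ id (s i) ∧ Submodule.span ℝ (s i) = F i := by
    intro i
    induction i with
    | zero => rw [hsz]; exact ⟨linearIndependent_empty ℝ V, by simp [h0]⟩
    | succ i ih => rw [hss]; exact (hf i (s i) ih).2
  have hmono : Monotone s := monotone_nat_of_le_succ fun i => hss i ▸ (hf i (s i) (hs i)).1
  -- Nothing new appears after stage `m`: `s m` already spans, so a further vector would be
  -- dependent on it.
  have hsm : ∀ i, s i ⊆ s m := by
    intro i
    rcases le_total i m with h | h
    · exact hmono h
    · intro x hx
      by_contra hxm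
      have hli := (hs i).1
      have h1 : x ∈ Submodule.span ℝ (s m) := by rw [(hs m).2, hm]; trivial
      have h3 : LinearIndepOn ℝ id (insert x (s m)) :=
        hli.mono (Set.insert_subset hx (hmono h))
      have h4 := (linearIndepOn_insert hxm).1 h3
      simp at h4
      exact h4.2 h1
  let B : Module.Basis ↥(s m) ℝ V := Module.Basis.mk (v := fun x : s m => (x : V)) (hs m).1 (by
    rw [show Set.range (fun x : s m => (x : V)) = s m by simp, (hs m).2, hm])
  have : Finite (s m) := Module.Finite.finite_basis B
  have : Fintype (s m) := Fintype.ofFinite _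
  have hc : Fintype.card (s m) = n := by rw [← hn, Module.finrank_eq_card_basis B]
  let e : s m ≃ Fin n := Fintype.equivFinOfCardEq hc
  have hb : ∀ j, (B.reindex e) j = (e.symm j : V) := by
    intro j
    rw [Module.Basis.reindex_apply]
    exact Module.Basis.mk_apply _ _ _
  have hex : ∀ j, ∃ i, (B.reindex e) j ∈ s i := fun j => ⟨m, by rw [hb]; exact (e.symm j).2⟩
  classical
  refine ⟨B.reindex e, fun j => Nat.find (hex j), fun j => ?_, fun i => ?_⟩
  · rw [← (hs _).2]
    exact Submodule.subset_span (Nat.find_spec (hex j))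
  · rw [← (hs i).2]
    congr 1
    ext x
    constructor
    · rintro ⟨j, hj, rfl⟩
      exact hmono hj (Nat.find_spec (hex j))
    · intro hx
      refine ⟨e ⟨x, hsm i hx⟩, ?_, by rw [hb]; simp⟩
      exact Nat.find_min' _ (by rw [hb]; simpa using hx)

namespace AdaptedBasis

variable {F : ℕ → Submodule ℝ V} {b : Module.Basis (Fin n) ℝ V} {w : Fin n → ℕ}

theorem pos (h : AdaptedBasis F b w) (h0 : F 0 = ⊥) (j : Fin n) : 0 < w j := by
  by_contra hj
  have h1 := h.mem j
  rw [show w j = 0 by omega, h0] at h1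
  exact b.ne_zero j h1

theorem mem_iff (h : AdaptedBasis F b w) (i : ℕ) (v : V) :
    v ∈ F i ↔ ∀ j, b.repr v j ≠ 0 → w j ≤ i := by
  rw [← h.span i, Module.Basis.mem_span_image]
  simp [Set.subset_def]

/-- At `i = 0` the truncated `i - 1` is harmless: `F 0` is zero and no vector has weight zero, so
both sides hold. -/
theorem mem_pred_iff (h : AdaptedBasis F b w) (h0 : F 0 = ⊥) (i : ℕ) (v : V) (hv : v ∈ F i) :
    v ∈ F (i - 1) ↔ ∀ j, w j = i → b.repr v j = 0 := by
  rw [h.mem_iff] at hv ⊢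
  constructor
  · intro h1 j hj
    by_contra h2
    have := h1 j h2
    have := h.pos h0 j
    omega
  · intro h1 j hj
    have := hv j hj
    have := mt (h1 j) hj
    omega

/-- A change of basis that respects the blocks of constant weight. -/
theorem exists_of_blocks [FiniteDimensional ℝ V] (h : AdaptedBasis F b w) (c : Fin n → V)
    (hc : ∀ i, Submodule.span ℝ (c '' {j | w j = i}) = Submodule.span ℝ (b '' {j | w j = i})) :
    ∃ b' : Module.Basis (Fin n) ℝ V, ⇑b' = c ∧ AdaptedBasis F b' w := by
  have key : ∀ (x y : Fin n → V), (∀ i, Submodule.span ℝ (x '' {j | w j = i}) =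
      Submodule.span ℝ (y '' {j | w j = i})) → ∀ i, Submodule.span ℝ (x '' {j | w j ≤ i}) ≤
      Submodule.span ℝ (y '' {j | w j ≤ i}) := by
    intro x y hxy i
    rw [Submodule.span_le]
    rintro _ ⟨j, hj, rfl⟩
    have h1 : x j ∈ Submodule.span ℝ (x '' {k | w k = w j}) :=
      Submodule.subset_span ⟨j, rfl, rfl⟩
    rw [hxy] at h1
    refine Submodule.span_mono (Set.image_mono ?_) h1
    intro k hk
    exact (le_of_eq hk).trans hj
  have hs : ∀ i, Submodule.span ℝ (c '' {j | w j ≤ i}) = F i := fun i =>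
    (le_antisymm (key c b hc i) (key b c (fun i => (hc i).symm) i)).trans (h.span i)
  have hw : {j | w j ≤ Finset.univ.sup w} = Set.univ := by
    ext j
    simpa using Finset.le_sup (f := w) (Finset.mem_univ j)
  have ht : ⊤ ≤ Submodule.span ℝ (Set.range c) := by
    have h1 := hs (Finset.univ.sup w)
    rw [← h.span, hw, Set.image_univ, Set.image_univ, b.span_eq] at h1
    exact h1.ge
  have hcard : Fintype.card (Fin n) = Module.finrank ℝ V :=
    (Module.finrank_eq_card_basis b).symm
  refine ⟨basisOfTopLeSpanOfCardEqFinrank c ht hcard, by simp, fun j => ?_, fun i => ?_⟩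
  · rw [← hs]
    exact Submodule.subset_span ⟨j, by simp, by simp⟩
  · simpa using hs i

theorem card_le_eq (h : AdaptedBasis F b w) (i : ℕ) :
    (Finset.univ.filter fun j => w j ≤ i).card = Module.finrank ℝ (F i) := by
  have h1 : LinearIndependent ℝ (fun j : {j // w j ≤ i} => b j) :=
    b.linearIndependent.comp _ Subtype.val_injective
  have h2 := finrank_span_eq_card h1
  rw [show Set.range (fun j : {j // w j ≤ i} => b j) = b '' {j | w j ≤ i} by
    ext; simp, h.span] at h2
  rw [h2, Fintype.card_subtype]

theorem card_eq {b' : Module.Basis (Fin n) ℝ V} {w' : Fin n → ℕ} (h : AdaptedBasis F b w)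
    (h' : AdaptedBasis F b' w') (i : ℕ) :
    (Finset.univ.filter fun j => w j = i).card = (Finset.univ.filter fun j => w' j = i).card := by
  have key : ∀ x : Fin n → ℕ, (Finset.univ.filter fun j => x j ≤ i).card =
      (Finset.univ.filter fun j => x j = i).card + (Finset.univ.filter fun j => x j < i).card := by
    intro x
    rw [← Finset.card_union_of_disjoint]
    · congr 1
      ext j
      simp [le_iff_eq_or_lt]
    · rw [Finset.disjoint_filter]
      intro j _ h1 h2
      omega
  have hlt : (Finset.univ.filter fun j => w j < i).card =
      (Finset.univ.filter fun j => w' j < i).card := by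
    cases i with
    | zero => simp
    | succ i =>
      simp only [Nat.lt_succ_iff]
      rw [h.card_le_eq, h'.card_le_eq]
  have h1 := key w
  have h2 := key w'
  rw [h.card_le_eq] at h1
  rw [h'.card_le_eq] at h2
  omega

/-- The dimensions of the subspaces determine how many vectors have each weight, so the weights of
two adapted bases differ only in order. -/
theorem exists_perm {b' : Module.Basis (Fin n) ℝ V} {w' : Fin n → ℕ} (h : AdaptedBasis F b w)
    (h' : AdaptedBasis F b' w') : ∃ σ : Equiv.Perm (Fin n), ∀ j, w' (σ j) = w j := by
  have e : ∀ i, Nonempty ({j // w j = i} ≃ {j // w' j = i}) := fun i =>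
    Fintype.card_eq.1 (by rw [Fintype.card_subtype, Fintype.card_subtype, h.card_eq h'])
  let σ : Equiv.Perm (Fin n) := (Equiv.sigmaFiberEquiv w).symm.trans
    ((Equiv.sigmaCongrRight fun i => (e i).some).trans (Equiv.sigmaFiberEquiv w'))
  exact ⟨σ, fun j => ((e (w j)).some ⟨j, rfl⟩).2⟩

theorem reindex (h : AdaptedBasis F b w) (σ : Equiv.Perm (Fin n)) :
    AdaptedBasis F (b.reindex σ.symm) (w ∘ σ) := by
  refine ⟨fun j => by simpa using h.mem (σ j), fun i => ?_⟩
  rw [← h.span i]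
  congr 1
  ext x
  constructor
  · rintro ⟨j, hj, rfl⟩
    exact ⟨σ j, hj, by simp⟩
  · rintro ⟨j, hj, rfl⟩
    exact ⟨σ.symm j, by simpa using hj, by simp⟩

end AdaptedBasis

/-- Polarization turns preservation of the quadratic form into `Aᵀ A = 1`. -/
theorem sq_det_eq_one_of_dotProduct_mulVec {ι : Type*} [Fintype ι] [DecidableEq ι]
    (A : Matrix ι ι ℝ) (h : ∀ t, A.mulVec t ⬝ᵥ A.mulVec t = t ⬝ᵥ t) : A.det ^ 2 = 1 := by
  have h2 : ∀ t u, A.mulVec t ⬝ᵥ A.mulVec u = t ⬝ᵥ u := by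
    intro t u
    have h1 := h (t + u)
    simp only [Matrix.mulVec_add, dotProduct_add, add_dotProduct, h] at h1
    rw [dotProduct_comm u t, dotProduct_comm (A.mulVec u) (A.mulVec t)] at h1
    linarith
  have h3 : A.transpose * A = 1 := by
    ext i j
    have h4 := h2 (Pi.single i 1) (Pi.single j 1)
    rw [Matrix.mulVec_single_one, Matrix.mulVec_single_one] at h4
    rw [Matrix.mul_apply']
    refine Eq.trans h4 ?_
    simp [Matrix.one_apply, Pi.single_apply, eq_comm]
  have h5 := congrArg Matrix.det h3
  rw [Matrix.det_mul, Matrix.det_transpose, Matrix.det_one] at h5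
  rw [sq, h5]

variable {F : ℕ → Submodule ℝ V} {b b' : Module.Basis (Fin n) ℝ V} {w w' : Fin n → ℕ}

/-- Both bases are adapted, so the transition matrix is block triangular for the weights. The
function `N i` descends to the quotient `F i / F (i - 1)` and is the standard quadratic form in both
bases; hence each diagonal block is orthogonal. -/
theorem AdaptedBasis.sq_det_eq_one_of_same_weights (h0 : F 0 = ⊥) (h : AdaptedBasis F b w)
    (h' : AdaptedBasis F b' w)
    (N : ℕ → V → ℝ) (hN : ∀ i u v, u - v ∈ F (i - 1) → N i u = N i v)
    (hb : ∀ (i : ℕ) (t : Fin n → ℝ), N i (∑ j with w j = i, t j • b j) = ∑ j with w j = i, t j ^ 2)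
    (hb' : ∀ (i : ℕ) (t : Fin n → ℝ),
      N i (∑ j with w j = i, t j • b' j) = ∑ j with w j = i, t j ^ 2) :
    b.det b' ^ 2 = 1 := by
  classical
  set A := b.toMatrix b' with hA
  have hblock : A.BlockTriangular w := by
    intro i j hij
    by_contra hne
    have := (h.mem_iff _ _).1 (h'.mem j) i hne
    omega
  -- The weight-`a` part of `∑ t j • b' j` in the basis `b` is the diagonal block applied to `t`;
  -- the rest lies in `F (a - 1)` and is invisible to `N a`.
  have hkey : ∀ (a : ℕ) (t : Fin n → ℝ),
      ∑ i with w i = a, (∑ j with w j = a, A i j * t j) ^ 2 = ∑ j with w j = a, t j ^ 2 := by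
    intro a t
    rw [← hb, ← hb']
    apply hN
    have hmem : ∀ x : Fin n → ℝ, ∀ c : Module.Basis (Fin n) ℝ V, AdaptedBasis F c w →
        ∑ i with w i = a, x i • c i ∈ F a := by
      intro x c hc
      refine Submodule.sum_mem _ fun i hi => Submodule.smul_mem _ _ ?_
      rw [Finset.mem_filter] at hi
      exact hi.2 ▸ hc.mem i
    rw [h.mem_pred_iff h0 a _ (Submodule.sub_mem _ (hmem _ b h) (hmem _ b' h'))]
    intro k hk
    rw [map_sub, Finsupp.sub_apply, map_sum, map_sum, Finsupp.finsetSum_apply,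
      Finsupp.finsetSum_apply]
    rw [Finset.sum_eq_single k]
    · simp only [map_smul, Finsupp.smul_apply, Module.Basis.repr_self, Finsupp.single_eq_same,
        smul_eq_mul, mul_one]
      rw [sub_eq_zero]
      refine Finset.sum_congr rfl fun j _ => ?_
      rw [hA, Module.Basis.toMatrix_apply, mul_comm]
    · intro j _ hj
      simp [hj]
    · intro hk'
      exact absurd (by simpa using hk) hk'
  rw [Module.Basis.det_apply, hblock.det, ← Finset.prod_pow]
  refine Finset.prod_eq_one fun a _ => sq_det_eq_one_of_dotProduct_mulVec _ fun t => ?_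
  have h1 := hkey a (fun j => if hj : w j = a then t ⟨j, hj⟩ else 0)
  have hsub : ∀ f : Fin n → ℝ, ∑ j with w j = a, f j = ∑ j : {j // w j = a}, f j := fun f =>
    Finset.sum_subtype _ (by simp) f
  simp only [hsub] at h1
  have hif : ∀ (x : {j // w j = a}) (g : w x = a → ℝ), (if hj : w x = a then g hj else 0) =
      g x.2 := fun x g => dif_pos x.2
  simp only [hif] at h1
  simp only [dotProduct, Matrix.mulVec, Matrix.toSquareBlock_def, Matrix.of_apply]
  simpa only [sq] using h1

theorem weight_sum {w w' : Fin n → ℕ} {σ : Equiv.Perm (Fin n)} (hσ : ∀ j, w' (σ j) = w j)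
    {W : Type*} [AddCommMonoid W] {i : ℕ} (f : Fin n → W) :
    ∑ j with w' j = i, f j = ∑ j with w j = i, f (σ j) := by
  refine (Finset.sum_bij (fun j _ => σ j) ?_ ?_ ?_ ?_).symm
  · intro j hj; simpa [hσ] using hj
  · intro j _ k _ hjk; exact σ.injective hjk
  · intro j hj
    refine ⟨σ.symm j, ?_, by simp⟩
    rw [Finset.mem_filter] at hj ⊢
    refine ⟨Finset.mem_univ _, ?_⟩
    rw [← hσ]; simpa using hj.2
  · intro j _; rfl

/-- A permutation makes the weights agree and changes the determinant only by a sign. -/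
theorem AdaptedBasis.abs_det_eq_one (h0 : F 0 = ⊥) (h : AdaptedBasis F b w)
    (h' : AdaptedBasis F b' w')
    (N : ℕ → V → ℝ) (hN : ∀ i u v, u - v ∈ F (i - 1) → N i u = N i v)
    (hb : ∀ (i : ℕ) (t : Fin n → ℝ), N i (∑ j with w j = i, t j • b j) = ∑ j with w j = i, t j ^ 2)
    (hb' : ∀ (i : ℕ) (t : Fin n → ℝ),
      N i (∑ j with w' j = i, t j • b' j) = ∑ j with w' j = i, t j ^ 2) :
    |b.det b'| = 1 := by
  obtain ⟨σ, hσ⟩ := h.exists_perm h'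
  have h2 := h'.reindex σ
  rw [show w' ∘ σ = w from funext hσ] at h2
  have h3 := AdaptedBasis.sq_det_eq_one_of_same_weights h0 h h2 N hN hb (by
    intro i t
    have h4 := hb' i (t ∘ σ.symm)
    rw [weight_sum hσ, weight_sum hσ] at h4
    simpa using h4)
  have h5 : b.det (b'.reindex σ.symm) = Equiv.Perm.sign σ • b.det b' := by
    have : ⇑(b'.reindex σ.symm) = b' ∘ σ := by ext; simp
    rw [this, AlternatingMap.map_perm]
  rw [h5] at h3
  rw [← abs_one, ← sq_eq_sq_iff_abs_eq_abs, one_pow, ← h3]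
  rcases Int.units_eq_one_or (Equiv.Perm.sign σ) with hs | hs <;> simp [hs]

/-- The linear map that sends the basis vectors of weight `i` to prescribed vectors, and the other
ones to zero. -/
def blockMap {W : Type*} [AddCommGroup W] [Module ℝ W] (b : Module.Basis (Fin n) ℝ V)
    (w : Fin n → ℕ) (i : ℕ) (c : Fin n → W) : V →ₗ[ℝ] W :=
  ∑ j with w j = i, (b.coord j).smulRight (c j)

theorem blockMap_apply {W : Type*} [AddCommGroup W] [Module ℝ W] (b : Module.Basis (Fin n) ℝ V)
    (w : Fin n → ℕ) (i : ℕ) (c : Fin n → W) (v : V) :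
    blockMap b w i c v = ∑ j with w j = i, b.repr v j • c j := by
  simp [blockMap, LinearMap.sum_apply]

theorem blockMap_basis {W : Type*} [AddCommGroup W] [Module ℝ W] (b : Module.Basis (Fin n) ℝ V)
    (w : Fin n → ℕ) (i : ℕ) (c : Fin n → W) (j : Fin n) :
    blockMap b w i c (b j) = if w j = i then c j else 0 := by
  rw [blockMap_apply]
  simp [Finsupp.single_apply, Finset.sum_ite_eq]

theorem blockMap_mem_span {W : Type*} [AddCommGroup W] [Module ℝ W]
    (b : Module.Basis (Fin n) ℝ V) (w : Fin n → ℕ) (i : ℕ) (c : Fin n → W) (v : V) :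
    blockMap b w i c v ∈ Submodule.span ℝ (c '' {j | w j = i}) := by
  rw [blockMap_apply]
  refine Submodule.sum_mem _ fun j hj => Submodule.smul_mem _ _ (Submodule.subset_span ?_)
  exact ⟨j, (Finset.mem_filter.1 hj).2, rfl⟩

/-- On `F i` the block map has kernel `F (i - 1)`, so it is a concrete model of the quotient `F i /
F (i - 1)`. -/
theorem AdaptedBasis.blockMap_eq_zero_iff {W : Type*} [AddCommGroup W] [Module ℝ W]
    (h0 : F 0 = ⊥) (h : AdaptedBasis F b w) {c : Fin n → W} (hc : LinearIndependent ℝ c)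
    {i : ℕ} {v : V} (hv : v ∈ F i) : blockMap b w i c v = 0 ↔ v ∈ F (i - 1) := by
  rw [h.mem_pred_iff h0 i v hv, blockMap_apply]
  constructor
  · intro h1 j hj
    exact linearIndependent_iff'.1 hc _ _ h1 j (by simpa using hj)
  · intro h1
    refine Finset.sum_eq_zero fun j hj => ?_
    rw [h1 j (Finset.mem_filter.1 hj).2, zero_smul]

end AdaptedBasis

/-! ### The flag of a distribution -/

section FlagLemmas

variable {n : ℕ} {M : Type} [TopologicalSpace M] [ChartedSpace (EuclideanSpace ℝ (Fin n)) M]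
  [IsManifold (𝓡 n) ∞ M] {D : ∀ x : M, Submodule ℝ (TangentSpace (𝓡 n) x)}

theorem flagFields_mono : Monotone (flagFields D) :=
  monotone_nat_of_le_succ flagFields_le_succ

theorem flag_mono (q : M) : Monotone fun i => flag D i q :=
  fun _ _ h => Submodule.map_mono (flagFields_mono h)

theorem flag_zero (q : M) : flag D 0 q = ⊥ := Submodule.map_bot _

theorem mem_flag_iff {i : ℕ} {q : M} {v : TangentSpace (𝓡 n) q} :
    v ∈ flag D i q ↔ ∃ X ∈ flagFields D i, X q = v := Iff.rfl

/-- Induction principle for `flagFields`. -/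
theorem flagFields_induction {p : ℕ → VField n M → Prop}
    (zero : ∀ i, p i 0)
    (add : ∀ i X Y, X ∈ flagFields D i → Y ∈ flagFields D i → p i X → p i Y → p i (X + Y))
    (smul : ∀ i (c : ℝ) X, X ∈ flagFields D i → p i X → p i (c • X))
    (horizontal : ∀ X ∈ horizontalFields D, p 1 X)
    (succ : ∀ i, ∀ X ∈ flagFields D i, p i X → p (i + 1) X)
    (bracket : ∀ i, ∀ X ∈ flagFields D (i + 1), ∀ Y ∈ horizontalFields D, p (i + 1) X →
      p (i + 2) (mlieBracket (𝓡 n) X Y)) {i : ℕ} :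
    ∀ X ∈ flagFields D i, p i X := by
  induction i using Nat.twoStepInduction with
  | zero =>
    intro X hX
    rw [(Submodule.mem_bot ℝ).1 hX]
    exact zero 0
  | one => exact horizontal
  | more i _ ih =>
    have hle : flagFields D (i + 2) ≤
        { carrier := {X | X ∈ flagFields D (i + 2) ∧ p (i + 2) X}
          add_mem' := fun hX hY => ⟨Submodule.add_mem _ hX.1 hY.1, add _ _ _ hX.1 hY.1 hX.2 hY.2⟩
          zero_mem' := ⟨Submodule.zero_mem _, zero _⟩
          smul_mem' := fun c X hX => ⟨Submodule.smul_mem _ c hX.1, smul _ c X hX.1 hX.2⟩ :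
            Submodule ℝ (VField n M) } := by
      refine sup_le (fun X hX => ⟨flagFields_le_succ _ hX, succ _ X hX (ih X hX)⟩)
        (Submodule.span_le.2 ?_)
      rintro _ ⟨X, hX, Y, hY, rfl⟩
      exact ⟨mlieBracket_mem_flagFields (j := 1) hX hY, bracket i X hX Y hY (ih X hX)⟩
    exact fun X hX => (hle hX).2

/-- Iterated brackets of `i` horizontal fields are sections of `Dⁱ`. -/
theorem nestedBracket_mem_flagFields : ∀ {i : ℕ} (X : Fin i → VField n M),
    (∀ l, X l ∈ horizontalFields D) →
    OrientedStructure.nestedBracket (List.ofFn X) ∈ flagFields D i := by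
  intro i
  induction i using Nat.twoStepInduction with
  | zero => intro X _; exact Submodule.zero_mem _
  | one => intro X hX; exact hX 0
  | more i _ ih =>
    intro X hX
    have h1 := mlieBracket_mem_flagFields (i := 1) (hX 0) (ih (fun l => X l.succ) fun l => hX _)
    rw [show 1 + (i + 1) = i + 2 by omega] at h1
    rw [List.ofFn_succ, List.ofFn_succ]
    rw [List.ofFn_succ] at h1
    exact h1

end FlagLemmas

/-! ### Tangent spaces as finite-dimensional spaces -/

section Coordinates
variable {n : ℕ}

instance tangentSpace_finiteDimensional {M : Type} [TopologicalSpace M]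
    [ChartedSpace (EuclideanSpace ℝ (Fin n)) M] (q : M) :
    FiniteDimensional ℝ (TangentSpace (𝓡 n) q) :=
  inferInstanceAs (FiniteDimensional ℝ (EuclideanSpace ℝ (Fin n)))

theorem finrank_tangentSpace {M : Type} [TopologicalSpace M]
    [ChartedSpace (EuclideanSpace ℝ (Fin n)) M] (q : M) :
    Module.finrank ℝ (TangentSpace (𝓡 n) q) = n := by
  have : Module.finrank ℝ (EuclideanSpace ℝ (Fin n)) = n := by simp
  exact this

/-- The standard basis of a tangent space, seen as the model space. -/
def tangentBasis {M : Type} [TopologicalSpace M]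
    [ChartedSpace (EuclideanSpace ℝ (Fin n)) M] (q : M) :
    Module.Basis (Fin n) ℝ (TangentSpace (𝓡 n) q) :=
  Module.finBasisOfFinrankEq ℝ _ (finrank_tangentSpace q)

end Coordinates

/-! ### Adapted bases, horizontal fields and rank at a point -/

namespace OrientedStructure

variable {n : ℕ} (M : OrientedStructure n)

theorem exists_flagAt_eq_top (q : M.carrier) : ∃ m, M.flagAt m q = ⊤ :=
  M.bracket_generating q

/-- Bracket generation supplies the extension: every tangent vector is the value of a section in the
flag, and those sections are smooth and globally defined, so no cut-off function is needed. -/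
theorem exists_smoothField (q : M.carrier) (v : TangentSpace (𝓡 n) q) :
    ∃ X : VField n M.carrier, SmoothField X ∧ X q = v := by
  obtain ⟨m, hm⟩ := M.exists_flagAt_eq_top q
  have hv : v ∈ M.flagAt m q := hm ▸ Submodule.mem_top
  obtain ⟨X, hX, hXv⟩ := mem_flag_iff.1 hv
  exact ⟨X, smoothField_of_mem_flagFields hX, hXv⟩

theorem isAdapted_iff {q : M.carrier} {b : Module.Basis (Fin n) ℝ (TangentSpace (𝓡 n) q)}
    {w : Fin n → ℕ} : M.IsAdapted q b w ↔ AdaptedBasis (fun i => M.flagAt i q) b w :=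
  ⟨fun h => ⟨h.mem, h.span⟩, fun h => ⟨h.mem, h.span⟩⟩

theorem exists_isAdapted (q : M.carrier) :
    ∃ (b : Module.Basis (Fin n) ℝ (TangentSpace (𝓡 n) q)) (w : Fin n → ℕ),
      M.IsAdapted q b w := by
  obtain ⟨m, hm⟩ := M.exists_flagAt_eq_top q
  obtain ⟨b, w, h⟩ := exists_adaptedBasis (F := fun i => M.flagAt i q) (flag_mono q)
    (flag_zero q) hm (finrank_tangentSpace q)
  exact ⟨b, w, M.isAdapted_iff.2 h⟩

theorem mem_dist_iff {q : M.carrier} {v : TangentSpace (𝓡 n) q} :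
    v ∈ M.dist q ↔ ∃ X : M.horizontal, X.1 q = v := by
  constructor
  · intro hv
    obtain ⟨X, hX, hX2⟩ := M.exists_frame q
    rw [← hX2.self_of_nhds.2] at hv
    obtain ⟨c, rfl⟩ := (Submodule.mem_span_range_iff_exists_fun ℝ).1 hv
    refine ⟨∑ i, c i • ⟨X i, hX i⟩, ?_⟩
    simp [Finset.sum_apply]
  · rintro ⟨X, rfl⟩
    exact X.2.2 q

theorem finrank_dist (q : M.carrier) : Module.finrank ℝ (M.dist q) = M.rank := by
  obtain ⟨X, hX, hX2⟩ := M.exists_frame q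
  rw [← hX2.self_of_nhds.2, finrank_span_eq_card hX2.self_of_nhds.1, Fintype.card_fin]

/-! ### Isometries act on fields -/

variable {M} {N : OrientedStructure n} (φ : M.carrier ≃ₘ^∞⟮𝓡 n, 𝓡 n⟯ N.carrier)

theorem mfderiv_symm_comp (q : M.carrier) (v : TangentSpace (𝓡 n) q) :
    mfderiv (𝓡 n) (𝓡 n) φ.symm (φ q) (mfderiv (𝓡 n) (𝓡 n) φ q v) = v := by
  have h := mfderiv_comp q (φ.symm.mdifferentiable (by simp) (φ q)) (φ.mdifferentiable (by simp) q)
  have h2 : φ.symm ∘ φ = id := funext φ.symm_apply_apply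
  rw [h2, mfderiv_id] at h
  exact (DFunLike.congr_fun h v).symm

theorem mfderiv_comp_symm (q : M.carrier) (v : TangentSpace (𝓡 n) (φ q)) :
    mfderiv (𝓡 n) (𝓡 n) φ q (mfderiv (𝓡 n) (𝓡 n) φ.symm (φ q) v) = v := by
  have h := mfderiv_comp (φ q) (φ.mdifferentiable (by simp) (φ.symm (φ q)))
    (φ.symm.mdifferentiable (by simp) (φ q))
  have h2 : φ ∘ φ.symm = id := funext φ.apply_symm_apply
  rw [h2, mfderiv_id, φ.symm_apply_apply] at h
  exact (DFunLike.congr_fun h v).symm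

/-- The differential of a diffeomorphism. -/
def tangentEquiv (q : M.carrier) :
    TangentSpace (𝓡 n) q ≃L[ℝ] TangentSpace (𝓡 n) (φ q) :=
  ContinuousLinearEquiv.equivOfInverse (mfderiv (𝓡 n) (𝓡 n) φ q)
    (mfderiv (𝓡 n) (𝓡 n) φ.symm (φ q)) (mfderiv_symm_comp φ q) (mfderiv_comp_symm φ q)

theorem isInvertible_mfderiv (q : M.carrier) : (mfderiv (𝓡 n) (𝓡 n) φ q).IsInvertible :=
  ⟨tangentEquiv φ q, rfl⟩

/-- The image of a vector field under a diffeomorphism. -/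
def pushField (X : VField n M.carrier) : VField n N.carrier :=
  mpullback (𝓡 n) (𝓡 n) φ.symm X

theorem pushField_apply (X : VField n M.carrier) (q : M.carrier) :
    pushField φ X (φ q) = mfderiv (𝓡 n) (𝓡 n) φ q (X q) := by
  have h : (mfderiv (𝓡 n) (𝓡 n) φ.symm (φ q)) =
      ((tangentEquiv φ q).symm : TangentSpace (𝓡 n) (φ q) →L[ℝ] TangentSpace (𝓡 n) q) := rfl
  rw [pushField, mpullback_apply]
  -- The point `φ.symm (φ q)` equals `q` only propositionally and the type of `X` depends on the
  -- point, so the equation is proved for every `p = q` and then specialized. The same device recurs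
  -- below.
  have h2 : ∀ p, p = q → (mfderiv (𝓡 n) (𝓡 n) φ.symm (φ q)).inverse (X p) =
      mfderiv (𝓡 n) (𝓡 n) φ q (X q) := by
    rintro p rfl
    erw [h, ContinuousLinearMap.inverse_equiv]
    rfl
  exact h2 _ (φ.symm_apply_apply q)

theorem SmoothField.pushField {X : VField n M.carrier} (hX : SmoothField X) :
    SmoothField (pushField φ X) := by
  have : IsManifold (𝓡 n) 1 M.carrier := IsManifold.of_le (n := ∞) (by simp)
  have : IsManifold (𝓡 n) 1 N.carrier := IsManifold.of_le (n := ∞) (by simp)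
  exact ContMDiff.mpullback_vectorField hX φ.symm.contMDiff
    (fun x => isInvertible_mfderiv φ.symm x) (by simp)

/-- Pushing forward is pulling back along `φ.symm`, so this is the naturality of the bracket under
pullbacks. -/
theorem pushField_mlieBracket {X Y : VField n M.carrier} (hX : SmoothField X)
    (hY : SmoothField Y) : pushField φ (mlieBracket (𝓡 n) X Y) =
      mlieBracket (𝓡 n) (pushField φ X) (pushField φ Y) := by
  have h2 : ∀ K : OrientedStructure n, IsManifold (𝓡 n) (minSmoothness ℝ 2) K.carrier := by
    intro K
    rw [minSmoothness_of_isRCLikeNormedField]; infer_instance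
  have h3 := h2 M
  have h4 := h2 N
  funext p
  exact mpullback_mlieBracket (hX.mdifferentiableAt _) (hY.mdifferentiableAt _)
    φ.symm.contMDiffAt (by
      rw [minSmoothness_of_isRCLikeNormedField]
      exact WithTop.coe_le_coe.2 (le_top : (2 : ℕ∞) ≤ ⊤))

variable {φ}

theorem IsIsometry.pushField_mem (h : IsIsometry M N φ) {X : VField n M.carrier}
    (hX : X ∈ M.horizontal) : pushField φ X ∈ N.horizontal := by
  refine ⟨SmoothField.pushField φ hX.1, fun p => ?_⟩
  obtain ⟨q, rfl⟩ : ∃ q, φ q = p := ⟨_, φ.apply_symm_apply p⟩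
  rw [pushField_apply, ← h.map_dist]
  exact ⟨X q, hX.2 q, rfl⟩

theorem IsIsometry.pushField_mem_flagFields (h : IsIsometry M N φ) {i : ℕ} :
    ∀ X ∈ flagFields M.dist i, pushField φ X ∈ flagFields N.dist i := by
  refine flagFields_induction (p := fun i X => pushField φ X ∈ flagFields N.dist i)
    ?_ ?_ ?_ ?_ ?_ ?_
  · intro i
    rw [pushField, mpullback_zero]
    exact Submodule.zero_mem _
  · intro i X Y _ _ hX hY
    rw [pushField, mpullback_add]
    exact Submodule.add_mem _ hX hY
  · intro i c X _ hX
    rw [pushField, mpullback_const_smul]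
    exact Submodule.smul_mem _ c hX
  · exact fun X hX => h.pushField_mem hX
  · exact fun i X _ hX => flagFields_le_succ _ hX
  · intro i X hX Y hY ih
    rw [pushField_mlieBracket φ (smoothField_of_mem_flagFields hX) hY.1]
    exact mlieBracket_mem_flagFields (j := 1) ih (h.pushField_mem hY)

theorem IsIsometry.symm (h : IsIsometry M N φ) : IsIsometry N M φ.symm := by
  constructor
  · intro p
    obtain ⟨q, rfl⟩ : ∃ q, φ q = p := ⟨_, φ.apply_symm_apply p⟩
    rw [← h.map_dist, ← Submodule.map_comp]
    have h1 : ((mfderiv (𝓡 n) (𝓡 n) φ.symm (φ q)).toLinearMap.comp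
        (mfderiv (𝓡 n) (𝓡 n) φ q).toLinearMap) = LinearMap.id :=
      LinearMap.ext fun v => mfderiv_symm_comp φ q v
    erw [h1]
    have h2 : ∀ p, p = q →
        (M.dist q).map (LinearMap.id (R := ℝ) (M := TangentSpace (𝓡 n) q)) = M.dist p := by
      rintro p rfl
      exact Submodule.map_id _
    exact h2 _ (φ.symm_apply_apply q)
  · intro p v w v' w' hv hw
    obtain ⟨q, rfl⟩ : ∃ q, φ q = p := ⟨_, φ.apply_symm_apply p⟩
    have h2 : ∀ p, p = q → ∀ v' w' : M.dist p,
        (v' : TangentSpace (𝓡 n) p) = mfderiv (𝓡 n) (𝓡 n) φ.symm (φ q) v →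
        (w' : TangentSpace (𝓡 n) p) = mfderiv (𝓡 n) (𝓡 n) φ.symm (φ q) w →
        M.metric p v' w' = N.metric (φ q) v w := by
      rintro p rfl v' w' hv hw
      refine (h.map_metric _ v' w' v w ?_ ?_).symm
      · rw [hv, mfderiv_comp_symm]
      · rw [hw, mfderiv_comp_symm]
    exact h2 _ (φ.symm_apply_apply q) v' w' hv hw

theorem IsIsometry.rank_eq (h : IsIsometry M N φ) : N.rank = M.rank := by
  obtain ⟨q⟩ := (inferInstance : Nonempty M.carrier)
  rw [← M.finrank_dist q, ← N.finrank_dist (φ q), ← h.map_dist q]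
  exact LinearEquiv.finrank_map_eq (tangentEquiv φ q).toLinearEquiv _

end OrientedStructure

/-! ### Positive forms -/

section PositiveForms

variable {n : ℕ} {V : Type} [AddCommGroup V] [Module ℝ V] {o : Orientation ℝ V (Fin n)}
  {α β : V [⋀^Fin n]→ₗ[ℝ] ℝ}

theorem IsPositiveForm.ne_zero (h : IsPositiveForm o α) : α ≠ 0 := h.1

theorem IsPositiveForm.exists_eq_smul (h : IsPositiveForm o α) (h' : IsPositiveForm o β) :
    ∃ r : ℝ, 0 < r ∧ α = r • β := by
  obtain ⟨hα, h1⟩ := h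
  obtain ⟨hβ, h2⟩ := h'
  obtain ⟨r, hr, hrr⟩ := ((ray_eq_iff hβ hα).1 (h2.trans h1.symm)).exists_pos_left hβ hα
  exact ⟨r, hr, hrr.symm⟩

theorem IsPositiveForm.smul (h : IsPositiveForm o α) {r : ℝ} (hr : 0 < r) :
    IsPositiveForm o (r • α) := by
  obtain ⟨hα, rfl⟩ := h
  exact ⟨smul_ne_zero hr.ne' hα, (ray_eq_iff _ _).2 (SameRay.sameRay_pos_smul_left α hr)⟩

theorem IsPositiveForm.neg (h : IsPositiveForm o α) : IsPositiveForm (-o) (-α) := by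
  obtain ⟨hα, rfl⟩ := h
  exact ⟨neg_ne_zero.2 hα, (neg_rayOfNeZero ℝ α hα).symm⟩

theorem IsPositiveForm.neg_of_neg (h : IsPositiveForm (-o) α) : IsPositiveForm o (-α) :=
  neg_neg o ▸ h.neg

theorem IsPositiveForm.smul_of_neg (h : IsPositiveForm o α) {r : ℝ} (hr : r < 0) :
    IsPositiveForm (-o) (r • α) := by
  have h1 : -((-r) • α) = r • α := by
    ext v
    simp
  exact h1 ▸ (h.smul (neg_pos.2 hr)).neg

theorem IsPositiveForm.of_neg_compLinearMap {W : Type} [AddCommGroup W] [Module ℝ W]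
    {γ : W [⋀^Fin n]→ₗ[ℝ] ℝ} {L : V →ₗ[ℝ] W} (h : IsPositiveForm o ((-γ).compLinearMap L)) :
    IsPositiveForm (-o) (γ.compLinearMap L) := by
  have h1 : -((-γ).compLinearMap L) = γ.compLinearMap L := by
    ext v
    simp
  exact h1 ▸ h.neg

theorem isPositiveForm_or_neg [FiniteDimensional ℝ V] (hn : Module.finrank ℝ V = n)
    (o : Orientation ℝ V (Fin n)) (hα : α ≠ 0) :
    IsPositiveForm o α ∨ IsPositiveForm o (-α) := by
  rcases Orientation.eq_or_eq_neg (rayOfNeZero ℝ α hα) o (by simp [hn]) with h | h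
  · exact Or.inl ⟨hα, h⟩
  · refine Or.inr ?_
    have h1 : IsPositiveForm (-o) α := ⟨hα, h⟩
    exact h1.neg_of_neg

end PositiveForms

/-! ### Ratios of top-degree forms -/

section FormRatio

variable {n : ℕ} {M : Type} [TopologicalSpace M] [ChartedSpace (EuclideanSpace ℝ (Fin n)) M]

/-- The quotient of two top-degree forms. -/
def formRatio (α β : TopForm n M) (q : M) : ℝ :=
  α q (tangentBasis q) / β q (tangentBasis q)

theorem form_apply_basis_ne_zero {α : TopForm n M} {q : M} (h : α q ≠ 0)
    (b : Module.Basis (Fin n) ℝ (TangentSpace (𝓡 n) q)) : α q b ≠ 0 :=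
  ((α q).map_basis_ne_zero_iff b).2 h

/-- A top-degree form is determined by its value on one basis: on other families of distinct basis
vectors it changes by the sign of a permutation. -/
theorem eq_formRatio_smul (α : TopForm n M) {β : TopForm n M} {q : M} (h : β q ≠ 0) :
    α q = formRatio α β q • β q := by
  refine Module.Basis.ext_alternating (tangentBasis q) fun v hv => ?_
  have key : α q (tangentBasis q) = (formRatio α β q • β q) (tangentBasis q) := by
    rw [AlternatingMap.smul_apply, formRatio, smul_eq_mul,
      div_mul_cancel₀ _ (form_apply_basis_ne_zero h _)]
  have hbij : Function.Bijective v := Finite.injective_iff_bijective.1 hv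
  have h1 := (α q).map_perm (tangentBasis q) (Equiv.ofBijective v hbij)
  have h2 := (formRatio α β q • β q).map_perm (tangentBasis q) (Equiv.ofBijective v hbij)
  rw [key, ← h2] at h1
  exact h1

theorem formRatio_eq_of_eq_smul {α β : TopForm n M} {q : M} (h : β q ≠ 0) {a : ℝ}
    (ha : α q = a • β q) : formRatio α β q = a := by
  rw [formRatio, ha, AlternatingMap.smul_apply, smul_eq_mul,
    mul_div_cancel_right₀ _ (form_apply_basis_ne_zero h _)]

theorem formRatio_apply {α β : TopForm n M} {q : M} (h : β q ≠ 0)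
    {v : Fin n → TangentSpace (𝓡 n) q} (hv : β q v ≠ 0) :
    formRatio α β q = α q v / β q v := by
  rw [eq_formRatio_smul α h, AlternatingMap.smul_apply, smul_eq_mul, mul_div_cancel_right₀ _ hv]

theorem formRatio_ne_zero {α β : TopForm n M} {q : M} (hα : α q ≠ 0) (h : β q ≠ 0) :
    formRatio α β q ≠ 0 :=
  div_ne_zero (form_apply_basis_ne_zero hα _) (form_apply_basis_ne_zero h _)

end FormRatio

/-! ### Smoothness of ratios, and the orientation character of a diffeomorphism -/

namespace OrientedStructure

variable {n : ℕ} (M : OrientedStructure n) {N : OrientedStructure n}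

/-- The bases `tangentBasis` need not vary smoothly. The ratio does not depend on the vectors it is
evaluated on, so near `q` they are replaced by smooth fields that extend the basis at `q`. -/
theorem contMDiff_formRatio {α β : TopForm n M.carrier} (hα : SmoothForm α) (hβ : SmoothForm β)
    (h : ∀ q, β q ≠ 0) : ContMDiff (𝓡 n) 𝓘(ℝ) ∞ (formRatio α β) := by
  intro q
  choose X hX hXq using fun i => M.exists_smoothField q (tangentBasis q i)
  have h1 : β q (fun i => X i q) ≠ 0 := by
    simp only [hXq]
    exact form_apply_basis_ne_zero (h q) _
  have h2 : ContMDiffAt (𝓡 n) 𝓘(ℝ) ∞ (fun x => α x (fun i => X i x) / β x (fun i => X i x)) q :=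
    (hα X hX q).div₀ (hβ X hX q) h1
  refine h2.congr_of_eventuallyEq ?_
  filter_upwards [(hβ X hX).continuous.continuousAt.eventually_ne h1] with x hx
  exact formRatio_apply (h x) hx

theorem smoothForm_pullbackForm (φ : M.carrier ≃ₘ^∞⟮𝓡 n, 𝓡 n⟯ N.carrier)
    {β : TopForm n N.carrier} (hβ : SmoothForm β) : SmoothForm (pullbackForm φ β) := by
  intro X hX
  have h1 := (hβ (fun i => pushField φ (X i)) fun i => SmoothField.pushField φ (hX i)).comp
    φ.contMDiff
  refine h1.congr fun x => ?_
  simp only [Function.comp_apply, pushField_apply]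
  rfl

variable {M} in
theorem pullbackForm_ne_zero (φ : M.carrier ≃ₘ^∞⟮𝓡 n, 𝓡 n⟯ N.carrier)
    {β : TopForm n N.carrier} {q : M.carrier} (hβ : β (φ q) ≠ 0) : pullbackForm φ β q ≠ 0 := by
  intro h
  let b := (tangentBasis q).map (tangentEquiv φ q).toLinearEquiv
  refine form_apply_basis_ne_zero hβ b ?_
  exact congrArg (fun γ => γ (tangentBasis q)) h

theorem pos_mul_of_continuous {X : Type*} [TopologicalSpace X] [PreconnectedSpace X]
    {f : X → ℝ} (hf : Continuous f) (h : ∀ x, f x ≠ 0) (x y : X) : 0 < f x * f y := by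
  by_contra hneg
  have key : ∃ z, f z = 0 := by
    rcases lt_or_gt_of_ne (h x) with hx | hx <;> rcases lt_or_gt_of_ne (h y) with hy | hy
    · exact absurd (mul_pos_of_neg_of_neg hx hy) hneg
    · exact mem_range_of_exists_le_of_exists_ge hf ⟨x, hx.le⟩ ⟨y, hy.le⟩
    · exact mem_range_of_exists_le_of_exists_ge hf ⟨y, hy.le⟩ ⟨x, hx.le⟩
    · exact absurd (mul_pos hx hy) hneg
  obtain ⟨z, hz⟩ := key
  exact h z hz

variable {M} in
-- One positive form is a sufficient test, since any other one is a positive multiple of it at each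
-- point.
theorem preservesOrientation_of_form (φ : M.carrier ≃ₘ^∞⟮𝓡 n, 𝓡 n⟯ N.carrier)
    {μ : TopForm n N.carrier} (hμ : ∀ p, IsPositiveForm (N.orientation p) (μ p))
    (h : ∀ q, IsPositiveForm (M.orientation q) (pullbackForm φ μ q)) :
    PreservesOrientation φ := by
  intro β hβ q
  obtain ⟨r, hr, hrr⟩ := (hβ (φ q)).exists_eq_smul (hμ (φ q))
  have h1 : pullbackForm φ β q = r • pullbackForm φ μ q := by
    simp only [pullbackForm, hrr]
    rfl
  rw [h1]
  exact (h q).smul hr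

variable {M} in
theorem reversesOrientation_of_form (φ : M.carrier ≃ₘ^∞⟮𝓡 n, 𝓡 n⟯ N.carrier)
    {μ : TopForm n N.carrier} (hμ : ∀ p, IsPositiveForm (N.orientation p) (μ p))
    (h : ∀ q, IsPositiveForm (-M.orientation q) (pullbackForm φ μ q)) :
    ReversesOrientation φ := by
  intro β hβ q
  obtain ⟨r, hr, hrr⟩ := (hβ (φ q)).exists_eq_smul (hμ (φ q))
  have h1 : pullbackForm φ β q = r • pullbackForm φ μ q := by
    simp only [pullbackForm, hrr]
    rfl
  rw [h1]
  exact (h q).smul hr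

variable {M} in
-- The pulled-back orientation form divided by that of `M` is continuous and nowhere zero, so on the
-- connected `M` it has constant sign.
theorem preserves_or_reversesOrientation (φ : M.carrier ≃ₘ^∞⟮𝓡 n, 𝓡 n⟯ N.carrier) :
    PreservesOrientation φ ∨ ReversesOrientation φ := by
  obtain ⟨μ, hμ, hμp⟩ := M.exists_orientation_form
  obtain ⟨ν, hν, hνp⟩ := N.exists_orientation_form
  have h0 : ∀ q, μ q ≠ 0 := fun q => (hμp q).ne_zero
  have h1 : ∀ q, pullbackForm φ ν q ≠ 0 := fun q => pullbackForm_ne_zero φ (hνp _).ne_zero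
  have hc := (M.contMDiff_formRatio (M.smoothForm_pullbackForm φ hν) hμ h0).continuous
  obtain ⟨q₀⟩ := (inferInstance : Nonempty M.carrier)
  have hpos := fun q => pos_mul_of_continuous hc (fun q => formRatio_ne_zero (h1 q) (h0 q)) q q₀
  rcases lt_or_gt_of_ne (formRatio_ne_zero (h1 q₀) (h0 q₀)) with hn | hp
  · refine Or.inr (reversesOrientation_of_form φ hνp fun q => ?_)
    have h2 : formRatio (pullbackForm φ ν) μ q < 0 := neg_of_mul_pos_left (hpos q) hn.le
    rw [eq_formRatio_smul (pullbackForm φ ν) (h0 q)]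
    exact (hμp q).smul_of_neg h2
  · refine Or.inl (preservesOrientation_of_form φ hνp fun q => ?_)
    have h2 : 0 < formRatio (pullbackForm φ ν) μ q := pos_of_mul_pos_left (hpos q) hp.le
    rw [eq_formRatio_smul (pullbackForm φ ν) (h0 q)]
    exact (hμp q).smul h2

/-! ### The opposite orientation -/

/-- The structure with the opposite orientation. -/
def opposite (M : OrientedStructure n) : OrientedStructure n where
  toSubRiemannian := M.toSubRiemannian
  equiregular := M.equiregular
  orientation := fun q => -M.orientation q
  exists_orientation_form := by
    obtain ⟨μ, hμ, hμp⟩ := M.exists_orientation_form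
    exact ⟨fun q => -μ q, fun X hX => (hμ X hX).neg, fun q => (hμp q).neg⟩

variable {M}

/-- The nilpotent approximation of the opposite structure is the opposite of the nilpotent
approximation. -/
def NilpotentApproximation.opposite {q : M.carrier} (A : M.NilpotentApproximation q) :
    M.opposite.NilpotentApproximation q where
  space := A.space.opposite
  group := A.group
  lieGroup := A.lieGroup
  simplyConnected := A.simplyConnected
  toLie := A.toLie
  toLie_bracket := A.toLie_bracket
  dist_eq := A.dist_eq
  metric_eq := A.metric_eq
  orientation_eq := by
    intro b w h α hα
    have h1 : IsPositiveForm (A.space.orientation 1) (-α) := IsPositiveForm.neg_of_neg hα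
    exact (A.orientation_eq b w ⟨h.mem, h.span⟩ (-α) h1).of_neg_compLinearMap

end OrientedStructure

/-! ### Invariant vector fields on Lie groups -/

theorem mulInvariantVectorField_one {n : ℕ} {G : Type} [TopologicalSpace G]
    [ChartedSpace (EuclideanSpace ℝ (Fin n)) G] [Group G] (v : GroupLieAlgebra (𝓡 n) G) :
    mulInvariantVectorField v 1 = v := by
  have h : ∀ f : G → G, f = id →
      (mfderiv (𝓡 n) (𝓡 n) f 1 v : EuclideanSpace ℝ (Fin n)) = v := by
    rintro _ rfl
    rw [mfderiv_id]
    rfl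
  exact h _ (funext one_mul)

section LieGroups

variable {n : ℕ} {G : Type} [TopologicalSpace G] [ChartedSpace (EuclideanSpace ℝ (Fin n)) G]
  [Group G] [LieGroup (𝓡 n) ∞ G]

theorem lieGroup_minSmoothness : LieGroup (𝓡 n) (minSmoothness ℝ 3) G := by
  rw [minSmoothness_of_isRCLikeNormedField]
  infer_instance

/-- The value at `g` is the differential of the multiplication at `(g, 1)` applied to `(0, v)`. The
field is thus a composition of smooth maps between tangent bundles. -/
theorem smoothField_mulInvariantVectorField (v : GroupLieAlgebra (𝓡 n) G) :
    SmoothField (mulInvariantVectorField v) := by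
  -- Passing to the tangent map costs one derivative, which is no loss at order `∞`.
  have A : (∞ : WithTop ℕ∞) + 1 = ∞ := rfl
  let fg : G → TangentBundle (𝓡 n) G := fun g => Bundle.TotalSpace.mk' _ g 0
  have sfg : ContMDiff (𝓡 n) (𝓡 n).tangent ∞ fg := Bundle.contMDiff_zeroSection _ _
  let fv : G → TangentBundle (𝓡 n) G := fun _ => Bundle.TotalSpace.mk' _ 1 v
  have sfv : ContMDiff (𝓡 n) (𝓡 n).tangent ∞ fv := contMDiff_const
  let F₁ : G → (TangentBundle (𝓡 n) G × TangentBundle (𝓡 n) G) := fun g => (fg g, fv g)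
  have S₁ : ContMDiff (𝓡 n) ((𝓡 n).tangent.prod (𝓡 n).tangent) ∞ F₁ := sfg.prodMk sfv
  let F₂ : (TangentBundle (𝓡 n) G × TangentBundle (𝓡 n) G) →
      TangentBundle ((𝓡 n).prod (𝓡 n)) (G × G) :=
    (equivTangentBundleProd (𝓡 n) G (𝓡 n) G).symm
  have S₂ : ContMDiff ((𝓡 n).tangent.prod (𝓡 n).tangent) ((𝓡 n).prod (𝓡 n)).tangent ∞ F₂ :=
    contMDiff_equivTangentBundleProd_symm
  let F₃ : TangentBundle ((𝓡 n).prod (𝓡 n)) (G × G) → TangentBundle (𝓡 n) G :=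
    tangentMap ((𝓡 n).prod (𝓡 n)) (𝓡 n) (fun (p : G × G) => p.1 * p.2)
  have S₃ : ContMDiff ((𝓡 n).prod (𝓡 n)).tangent (𝓡 n).tangent ∞ F₃ := by
    apply ContMDiff.contMDiff_tangentMap _ (m := ∞) le_rfl
    rw [A]
    exact contMDiff_mul (𝓡 n) ∞
  refine ((S₃.comp S₂).comp S₁).congr fun g => ?_
  have h1 : ∀ u : EuclideanSpace ℝ (Fin n),
      (mfderiv ((𝓡 n).prod (𝓡 n)) (𝓡 n) (fun p : G × G => p.1 * p.2) (g, 1)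
        ((0, u) : EuclideanSpace ℝ (Fin n) × EuclideanSpace ℝ (Fin n)) : EuclideanSpace ℝ (Fin n)) =
      mfderiv (𝓡 n) (𝓡 n) (g * ·) (1 : G) u := by
    intro u
    have hm : MDifferentiableAt ((𝓡 n).prod (𝓡 n)) (𝓡 n) (fun p : G × G => p.1 * p.2) (g, 1) :=
      (contMDiff_mul (𝓡 n) ∞).mdifferentiableAt (by simp)
    have h3 := DFunLike.congr_fun (mfderiv_prod_eq_add_comp hm)
      ((0, u) : EuclideanSpace ℝ (Fin n) × EuclideanSpace ℝ (Fin n))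
    refine h3.trans ?_
    exact (congrArg (· + (mfderiv (𝓡 n) (𝓡 n) (g * ·) (1 : G) u : EuclideanSpace ℝ (Fin n)))
      (map_zero (mfderiv (𝓡 n) (𝓡 n) (· * (1 : G)) g))).trans (zero_add _)
  have h2 : ∀ (y : G) (u : EuclideanSpace ℝ (Fin n)), y = g →
      (⟨g, u⟩ : TangentBundle (𝓡 n) G) = ⟨y, u⟩ := by
    rintro _ _ rfl
    rfl
  refine (h2 (g * 1) _ (mul_one g)).trans ?_
  exact congrArg (fun u : EuclideanSpace ℝ (Fin n) => (⟨g * 1, u⟩ : TangentBundle (𝓡 n) G))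
    (h1 v).symm

/-- Left translation by `g`, as a diffeomorphism. -/
def leftTranslation (g : G) : G ≃ₘ^∞⟮𝓡 n, 𝓡 n⟯ G where
  toEquiv := Equiv.mulLeft g
  contMDiff_toFun := contMDiff_mul_left
  contMDiff_invFun := contMDiff_mul_left

theorem coe_leftTranslation (g : G) : ⇑(leftTranslation (n := n) g) = (g * ·) := rfl

/-- The left translation of the Lie algebra to the tangent space at `g`. -/
def mulInvariantMap (g : G) : GroupLieAlgebra (𝓡 n) G →ₗ[ℝ] TangentSpace (𝓡 n) g :=
  (mfderiv (𝓡 n) (𝓡 n) (g * ·) (1 : G)).toLinearMap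

/-- Pulling a left-invariant field back by the translation by `g` gives the same field, so its value
at `g` determines its value at the unit. -/
theorem mulInvariantMap_injective (g : G) :
    Function.Injective (mulInvariantMap (n := n) g) := by
  have := lieGroup_minSmoothness (n := n) (G := G)
  rw [injective_iff_map_eq_zero]
  intro v hv
  have h1 := congrFun (mpullback_mulInvariantVectorField g v) 1
  rw [mulInvariantVectorField_one, mpullback_apply] at h1
  have h2 : ∀ y, y = g → mulInvariantVectorField v y = 0 := by
    rintro _ rfl
    exact hv
  rw [h2 (g * 1) (mul_one g), map_zero] at h1
  exact h1.symm

/-- The left translation of the Lie algebra to the tangent space at `g`, as an equivalence. -/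
def mulInvariantEquiv (g : G) : GroupLieAlgebra (𝓡 n) G ≃ₗ[ℝ] TangentSpace (𝓡 n) g :=
  LinearEquiv.ofInjectiveOfFinrankEq (mulInvariantMap g) (mulInvariantMap_injective g)
    ((finrank_tangentSpace _).trans (finrank_tangentSpace _).symm)

theorem mulInvariantEquiv_apply (g : G) (v : GroupLieAlgebra (𝓡 n) G) :
    mulInvariantEquiv g v = mulInvariantVectorField v g := rfl

theorem mlieBracket_mulInvariantVectorField (v w : GroupLieAlgebra (𝓡 n) G) :
    mlieBracket (𝓡 n) (mulInvariantVectorField v) (mulInvariantVectorField w) =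
      mulInvariantVectorField ⁅v, w⁆ := by
  have := lieGroup_minSmoothness (n := n) (G := G)
  exact (mulInvariantVector_mlieBracket v w).symm

/-- The bracket of the Lie algebra of a Lie group, as a bilinear map. -/
def lieBilin : GroupLieAlgebra (𝓡 n) G →ₗ[ℝ] GroupLieAlgebra (𝓡 n) G →ₗ[ℝ]
    GroupLieAlgebra (𝓡 n) G :=
  have := lieGroup_minSmoothness (n := n) (G := G)
  LinearMap.mk₂ ℝ (fun v w => ⁅v, w⁆) (fun u v w => add_lie u v w) (fun c v w => smul_lie c v w)
    (fun u v w => lie_add u v w) (fun c v w => lie_smul c v w)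

theorem lieBilin_apply (v w : GroupLieAlgebra (𝓡 n) G) : lieBilin v w = ⁅v, w⁆ := rfl

theorem lieBilin_swap (v w : GroupLieAlgebra (𝓡 n) G) : lieBilin v w = -lieBilin w v := by
  have := lieGroup_minSmoothness (n := n) (G := G)
  rw [lieBilin_apply, lieBilin_apply]
  exact (lie_skew v w).symm

end LieGroups

/-! ### The Leibniz rule for combinations of vector fields -/

section BracketOfSums

variable {n : ℕ} {M : Type} [TopologicalSpace M] [ChartedSpace (EuclideanSpace ℝ (Fin n)) M]
  [IsManifold (𝓡 n) ∞ M]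

theorem SmoothField.sum {ι : Type*} (s : Finset ι) {X : ι → VField n M}
    (hX : ∀ i ∈ s, SmoothField (X i)) : SmoothField (∑ i ∈ s, X i) := by
  have : ∑ i ∈ s, X i ∈ horizontalFields (fun x : M => (⊤ : Submodule ℝ (TangentSpace (𝓡 n) x))) :=
    Submodule.sum_mem _ fun i hi => ⟨hX i hi, fun _ => trivial⟩
  exact this.1

theorem SmoothField.smul {f : M → ℝ} {X : VField n M} (hf : ContMDiff (𝓡 n) 𝓘(ℝ) ∞ f)
    (hX : SmoothField X) : SmoothField (f • X) :=
  ContMDiff.smul_section hf hX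

/-- The derivatives of the coefficients contribute only multiples of the fields `X i` themselves.
Their exact values never matter, hence the existential form. -/
theorem mlieBracket_sum_smul_left {ι : Type*} (s : Finset ι) {f : ι → M → ℝ}
    {X : ι → VField n M} (hf : ∀ i ∈ s, ContMDiff (𝓡 n) 𝓘(ℝ) ∞ (f i))
    (hX : ∀ i ∈ s, SmoothField (X i)) (W : VField n M) (x : M) :
    ∃ c : ι → ℝ, mlieBracket (𝓡 n) (∑ i ∈ s, f i • X i) W x =
      ∑ i ∈ s, (f i x • mlieBracket (𝓡 n) (X i) W x + c i • X i x) := by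
  classical
  have : IsManifold (𝓡 n) 2 M :=
    IsManifold.of_le (n := ∞) (WithTop.coe_le_coe.2 (le_top : (2 : ℕ∞) ≤ ⊤))
  refine ⟨fun i => -mvfderiv (𝓡 n) (f i) x (W x), ?_⟩
  induction s using Finset.induction_on with
  | empty => simp [mlieBracket_zero_left]
  | insert i s hi ih =>
    have h1 : ∀ j ∈ s, SmoothField (f j • X j) := fun j hj =>
      SmoothField.smul (hf j (Finset.mem_insert_of_mem hj)) (hX j (Finset.mem_insert_of_mem hj))
    have hfi := hf i (Finset.mem_insert_self i s)
    have hXi := hX i (Finset.mem_insert_self i s)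
    rw [Finset.sum_insert hi, Finset.sum_insert hi, mlieBracket_add_left
      ((SmoothField.smul hfi hXi).mdifferentiableAt x) ((SmoothField.sum s h1).mdifferentiableAt x),
      ih (fun j hj => hf j (Finset.mem_insert_of_mem hj))
        (fun j hj => hX j (Finset.mem_insert_of_mem hj)),
      mlieBracket_smul_left ((hfi x).mdifferentiableAt (by simp)) (hXi.mdifferentiableAt x)]
    congr 1
    rw [add_comm]

end BracketOfSums

/-! ### Vector fields on a Lie group in the left-invariant trivialization -/

namespace OrientedStructure

variable {n : ℕ} {G : OrientedStructure n} [Group G.carrier] [LieGroup (𝓡 n) ∞ G.carrier]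

/-- A vector field on a Lie group, seen as a map to the Lie algebra. -/
def trivialize (Z : VField n G.carrier) (g : G.carrier) : GroupLieAlgebra (𝓡 n) G.carrier :=
  (mulInvariantEquiv g).symm (Z g)

theorem mulInvariantVectorField_trivialize (Z : VField n G.carrier) (g : G.carrier) :
    mulInvariantVectorField (trivialize Z g) g = Z g :=
  (mulInvariantEquiv g).apply_symm_apply (Z g)

theorem trivialize_mulInvariantVectorField (v : GroupLieAlgebra (𝓡 n) G.carrier)
    (g : G.carrier) : trivialize (mulInvariantVectorField v) g = v :=
  (mulInvariantEquiv g).symm_apply_apply v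

theorem trivialize_one (Z : VField n G.carrier) : trivialize Z 1 = Z 1 := by
  rw [← mulInvariantVectorField_one (trivialize Z 1), mulInvariantVectorField_trivialize]

variable (β : Module.Basis (Fin n) ℝ (GroupLieAlgebra (𝓡 n) G.carrier))

/-- Cramer's rule in the left-invariant frame: a coefficient is a quotient of two values of the
orientation form, which is smooth and nowhere vanishing. -/
theorem contMDiff_repr_trivialize {Z : VField n G.carrier} (hZ : SmoothField Z) (k : Fin n) :
    ContMDiff (𝓡 n) 𝓘(ℝ) ∞ (fun g => β.repr (trivialize Z g) k) := by
  classical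
  obtain ⟨μ, hμ, hμp⟩ := G.exists_orientation_form
  let X : Fin n → VField n G.carrier := fun j => mulInvariantVectorField (β j)
  have hX : ∀ j, SmoothField (X j) := fun j => smoothField_mulInvariantVectorField _
  have h0 : ∀ g, μ g (fun j => X j g) ≠ 0 := fun g =>
    form_apply_basis_ne_zero (hμp g).ne_zero (β.map (mulInvariantEquiv g))
  have h1 : ∀ g, β.repr (trivialize Z g) k =
      μ g (fun j => (Function.update X k Z) j g) / μ g (fun j => X j g) := by
    intro g
    rw [eq_div_iff (h0 g)]
    have h2 : (fun j => (Function.update X k Z) j g) =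
        Function.update (fun j => X j g) k (∑ l, β.repr (trivialize Z g) l • X l g) := by
      have h3 : Z g = ∑ l, β.repr (trivialize Z g) l • X l g := by
        conv_lhs => rw [← mulInvariantVectorField_trivialize Z g,
          ← β.sum_repr (trivialize Z g)]
        rw [← mulInvariantEquiv_apply, map_sum]
        simp only [map_smul]
        rfl
      rw [← h3]
      funext j
      by_cases hj : j = k
      · subst hj; simp
      · simp [hj]
    rw [h2, AlternatingMap.map_update_sum, Finset.sum_eq_single k]
    · rw [AlternatingMap.map_update_smul, Function.update_eq_self, smul_eq_mul]
    · intro l _ hl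
      rw [AlternatingMap.map_update_smul, AlternatingMap.map_update_self _ _ hl.symm, smul_zero]
    · simp
  have h4 : (fun g => β.repr (trivialize Z g) k) = fun g =>
      μ g (fun j => (Function.update X k Z) j g) / μ g (fun j => X j g) := funext h1
  rw [h4]
  refine ContMDiff.div₀ (hμ _ fun j => ?_) (hμ X hX) h0
  by_cases hj : j = k
  · subst hj; simpa using hZ
  · simpa [hj] using hX j

theorem eq_sum_smul_mulInvariantVectorField {Z : VField n G.carrier} {I : Finset (Fin n)}
    (hI : ∀ g, trivialize Z g ∈ Submodule.span ℝ (β '' I)) :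
    Z = ∑ k ∈ I, (fun g => β.repr (trivialize Z g) k) • mulInvariantVectorField (β k) := by
  funext g
  conv_lhs => rw [← mulInvariantVectorField_trivialize Z g, ← β.sum_repr (trivialize Z g)]
  rw [← mulInvariantEquiv_apply, map_sum, Finset.sum_apply]
  simp only [map_smul]
  refine (Finset.sum_subset (Finset.subset_univ I) fun k _ hk => ?_).symm
  have h1 := β.mem_span_image.1 (hI g)
  have h2 : β.repr (trivialize Z g) k = 0 := by
    by_contra h3
    exact hk (h1 (Finsupp.mem_support_iff.2 h3))
  rw [h2, zero_smul]

/-- The bracket of two fields on a Lie group agrees with the bracket of their values in the Lie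
algebra, up to the derivatives of the coefficients. -/
theorem trivialize_mlieBracket_sub_mem {Z Z' : VField n G.carrier} (hZ : SmoothField Z)
    (hZ' : SmoothField Z') {I J : Finset (Fin n)}
    (hI : ∀ g, trivialize Z g ∈ Submodule.span ℝ (β '' I))
    (hJ : ∀ g, trivialize Z' g ∈ Submodule.span ℝ (β '' J)) (g : G.carrier) :
    trivialize (mlieBracket (𝓡 n) Z Z') g - lieBilin (trivialize Z g) (trivialize Z' g) ∈
      Submodule.span ℝ (β '' I) ⊔ Submodule.span ℝ (β '' J) := by
  set X : Fin n → VField n G.carrier := fun j => mulInvariantVectorField (β j) with hX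
  set f : Fin n → G.carrier → ℝ := fun k g => β.repr (trivialize Z g) k with hf
  set f' : Fin n → G.carrier → ℝ := fun k g => β.repr (trivialize Z' g) k with hf'
  have hXs : ∀ j, SmoothField (X j) := fun j => smoothField_mulInvariantVectorField _
  have hsum : ∀ (Y : VField n G.carrier) (K : Finset (Fin n)),
      (∀ g, trivialize Y g ∈ Submodule.span ℝ (β '' K)) →
      trivialize Y g = ∑ k ∈ K, β.repr (trivialize Y g) k • β k := by
    intro Y K hK
    conv_lhs => rw [← β.sum_repr (trivialize Y g)]
    refine (Finset.sum_subset (Finset.subset_univ K) fun k _ hk => ?_).symm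
    have h1 := β.mem_span_image.1 (hK g)
    have h2 : β.repr (trivialize Y g) k = 0 := by
      by_contra h3
      exact hk (h1 (Finsupp.mem_support_iff.2 h3))
    rw [h2, zero_smul]
  obtain ⟨c, hc⟩ := mlieBracket_sum_smul_left I (f := f) (X := X)
    (fun k _ => contMDiff_repr_trivialize β hZ k) (fun k _ => hXs k) Z' g
  rw [← eq_sum_smul_mulInvariantVectorField β hI] at hc
  -- The second argument is expanded by swapping the bracket, applying the Leibniz rule on the left
  -- and swapping back.
  have h1 : ∀ k, ∃ d : Fin n → ℝ, mlieBracket (𝓡 n) (X k) Z' g =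
      mulInvariantEquiv g (lieBilin (β k) (trivialize Z' g) + ∑ l ∈ J, d l • β l) := by
    intro k
    obtain ⟨d, hd⟩ := mlieBracket_sum_smul_left J (f := f') (X := X)
      (fun k _ => contMDiff_repr_trivialize β hZ' k) (fun k _ => hXs k) (X k) g
    rw [← eq_sum_smul_mulInvariantVectorField β hJ] at hd
    refine ⟨fun l => -d l, ?_⟩
    rw [mlieBracket_swap_apply, hd]
    conv_rhs => rw [hsum Z' J hJ]
    simp only [map_sum, map_add, map_smul, mulInvariantEquiv_apply, lieBilin_apply]
    rw [← Finset.sum_neg_distrib, ← Finset.sum_add_distrib]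
    refine Finset.sum_congr rfl fun l _ => ?_
    rw [← mlieBracket_mulInvariantVectorField, mlieBracket_swap_apply, smul_neg, neg_add, neg_neg,
      neg_smul]
  choose d hd using h1
  have h2 : trivialize (mlieBracket (𝓡 n) Z Z') g =
      lieBilin (trivialize Z g) (trivialize Z' g) +
        (∑ k ∈ I, c k • β k + ∑ k ∈ I, f k g • ∑ l ∈ J, d k l • β l) := by
    rw [trivialize, LinearEquiv.symm_apply_eq, hc]
    conv_rhs => rw [hsum Z I hI]
    simp only [hd, map_sum, map_add, map_smul, LinearMap.sum_apply, LinearMap.smul_apply,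
      smul_add, Finset.sum_add_distrib]
    rw [add_assoc]
    congr 1
    rw [add_comm]
    rfl
  rw [h2, add_sub_cancel_left]
  refine Submodule.add_mem _ (Submodule.mem_sup_left ?_) (Submodule.mem_sup_right ?_)
  · exact Submodule.sum_mem _ fun k hk => Submodule.smul_mem _ _
      (Submodule.subset_span ⟨k, hk, rfl⟩)
  · exact Submodule.sum_mem _ fun k hk => Submodule.smul_mem _ _ (Submodule.sum_mem _ fun l hl =>
      Submodule.smul_mem _ _ (Submodule.subset_span ⟨l, hl, rfl⟩))

end OrientedStructure

/-! ### Iterated brackets in a Lie algebra -/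

section NestedLie

variable {n : ℕ} {G : Type} [TopologicalSpace G] [ChartedSpace (EuclideanSpace ℝ (Fin n)) G]
  [Group G] [LieGroup (𝓡 n) ∞ G]

/-- The iterated bracket `[x₁, [x₂, …, [xᵢ₋₁, xᵢ]]]` in the Lie algebra of a Lie group. -/
def nestedLie (G : Type) [TopologicalSpace G] [ChartedSpace (EuclideanSpace ℝ (Fin n)) G]
    [Group G] [LieGroup (𝓡 n) ∞ G] :
    ∀ i : ℕ, MultilinearMap ℝ (fun _ : Fin i => GroupLieAlgebra (𝓡 n) G) (GroupLieAlgebra (𝓡 n) G)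
  | 0 => 0
  | 1 => MultilinearMap.ofSubsingleton ℝ _ _ 0 LinearMap.id
  | i + 2 => LinearMap.uncurryLeft
      { toFun := fun x => (lieBilin x).compMultilinearMap (nestedLie G (i + 1))
        map_add' := fun x y => by ext; simp
        map_smul' := fun c x => by ext; simp }

theorem nestedLie_zero (x : Fin 0 → GroupLieAlgebra (𝓡 n) G) : nestedLie G 0 x = 0 := rfl

theorem nestedLie_one (x : Fin 1 → GroupLieAlgebra (𝓡 n) G) : nestedLie G 1 x = x 0 := rfl

theorem nestedLie_succ {i : ℕ} (x : Fin (i + 2) → GroupLieAlgebra (𝓡 n) G) :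
    nestedLie G (i + 2) x = lieBilin (x 0) (nestedLie G (i + 1) fun l => x l.succ) := rfl

end NestedLie

/-! ### The flag and the iterated brackets of the nilpotent approximation -/

namespace OrientedStructure

variable {n : ℕ} {M : OrientedStructure n} {q : M.carrier}

theorem flag_one (M : OrientedStructure n) (q : M.carrier) : M.flagAt 1 q = M.dist q := by
  ext v
  rw [mem_dist_iff, mem_flag_iff]
  exact ⟨fun ⟨X, hX, hv⟩ => ⟨⟨X, hX⟩, hv⟩, fun ⟨X, hv⟩ => ⟨X.1, X.2, hv⟩⟩

namespace NilpotentApproximation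

variable (A : M.NilpotentApproximation q) {b : Module.Basis (Fin n) ℝ (TangentSpace (𝓡 n) q)}
  {w : Fin n → ℕ} (h : M.IsAdapted q b w)

/-- The Lie algebra of the nilpotent approximation. -/
abbrev lieAlg : Type := GroupLieAlgebra (𝓡 n) A.space.carrier

/-- The linear isomorphism from the tangent space to the Lie algebra of the nilpotent
approximation given by an adapted basis. -/
abbrev liftMap : TangentSpace (𝓡 n) q →ₗ[ℝ] A.lieAlg :=
  A.toLie.toLinearMap ∘ₗ M.thetaHat h

/-- The orientation condition carries the argument: `liftMap` pulls a positive form back to a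
positive, hence nonzero, form, which is impossible if the images of a basis are dependent. -/
theorem linearIndependent_liftMap : LinearIndependent ℝ (fun j => A.liftMap h (b j)) := by
  obtain ⟨μ, -, hμ⟩ := A.space.exists_orientation_form
  have h1 := (A.orientation_eq b w h (μ 1) (hμ 1)).ne_zero
  have h2 : (μ 1).compLinearMap (A.liftMap h) b ≠ 0 :=
    ((AlternatingMap.compLinearMap _ _).map_basis_ne_zero_iff b).2 h1
  by_contra h3
  exact h2 ((μ 1).map_linearDependent _ h3)

/-- The basis of the Lie algebra of the nilpotent approximation given by an adapted basis. -/
def lieBasis : Module.Basis (Fin n) ℝ A.lieAlg :=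
  basisOfLinearIndependentOfCardEqFinrank' _ (A.linearIndependent_liftMap h)
    ((Fintype.card_fin n).trans (finrank_tangentSpace _).symm)

theorem lieBasis_apply (j : Fin n) : A.lieBasis h j = A.liftMap h (b j) := by
  simp [lieBasis]

/-- The component of weight `i` of a vector, in the Lie algebra of the nilpotent
approximation. -/
def component (i : ℕ) : TangentSpace (𝓡 n) q →ₗ[ℝ] A.lieAlg :=
  blockMap b w i (A.lieBasis h)

theorem component_eq_zero_iff {i : ℕ} {v : TangentSpace (𝓡 n) q} (hv : v ∈ M.flagAt i q) :
    A.component h i v = 0 ↔ v ∈ M.flagAt (i - 1) q :=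
  (M.isAdapted_iff.1 h).blockMap_eq_zero_iff (flag_zero q) (A.lieBasis h).linearIndependent hv

/-- This replaces the classes in the direct sum of quotients by components with respect to an
adapted basis. Vectors of weight below `i` vanish on both sides. -/
theorem toLie_grClass (i : ℕ) (v : TangentSpace (𝓡 n) q) (hv : v ∈ M.flagAt i q) :
    A.toLie (M.grClass q i ⟨v, hv⟩) = A.component h i v := by
  suffices key : ∀ v ∈ Submodule.span ℝ (b '' {j | w j ≤ i}), ∀ hv : v ∈ M.flagAt i q,
      A.toLie (M.grClass q i ⟨v, hv⟩) = A.component h i v from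
    key v (by rw [h.span]; exact hv) hv
  intro v hv
  induction hv using Submodule.span_induction with
  | mem x hx =>
    obtain ⟨j, hj, rfl⟩ := hx
    intro hv
    rcases eq_or_lt_of_le (show w j ≤ i from hj) with rfl | hlt
    · rw [component, blockMap_basis, if_pos rfl, lieBasis_apply]
      simp [liftMap, thetaHat]
    · have h1 : b j ∈ M.flagAt (i - 1) q := flag_mono q (show w j ≤ i - 1 by omega) (h.mem j)
      rw [(A.component_eq_zero_iff h hv).2 h1]
      have h2 : M.grClass q i ⟨b j, hv⟩ = 0 := by
        rw [grClass, LinearMap.comp_apply, Submodule.mkQ_apply,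
          (Submodule.Quotient.mk_eq_zero _).2, map_zero]
        exact h1
      rw [h2, map_zero]
  | zero => 
    intro hv
    have : (⟨0, hv⟩ : M.flagAt i q) = 0 := rfl
    rw [this, map_zero, map_zero, map_zero]
  | add x y hx hy ihx ihy =>
    intro hv
    rw [h.span] at hx hy
    have : (⟨x + y, hv⟩ : M.flagAt i q) = ⟨x, hx⟩ + ⟨y, hy⟩ := rfl
    rw [this, map_add, map_add, map_add, ihx, ihy]
  | smul c x hx ihx =>
    intro hv
    rw [h.span] at hx
    have : (⟨c • x, hv⟩ : M.flagAt i q) = c • ⟨x, hx⟩ := rfl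
    rw [this, map_smul, map_smul, map_smul, ihx]

theorem toLie_symbol {i : ℕ} {X : VField n M.carrier} (hX : X ∈ flagFields M.dist i) :
    A.toLie (M.symbol q i X hX) = A.component h i (X q) :=
  A.toLie_grClass h i _ _

theorem component_mlieBracket {i j : ℕ} {X Y : VField n M.carrier}
    (hX : X ∈ flagFields M.dist i) (hY : Y ∈ flagFields M.dist j) :
    A.component h (i + j) (mlieBracket (𝓡 n) X Y q) =
      lieBilin (A.component h i (X q)) (A.component h j (Y q)) := by
  have h1 := A.toLie_bracket i j X Y hX hY
  rw [A.toLie_symbol h, A.toLie_symbol h, A.toLie_symbol h] at h1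
  exact h1

/-- The increasing filtration of the graded Lie algebra of the nilpotent approximation. -/
def filtration (i : ℕ) : Submodule ℝ A.lieAlg :=
  Submodule.span ℝ (A.lieBasis h '' {j | w j ≤ i})

theorem filtration_mono : Monotone (A.filtration h) := fun _ _ hij =>
  Submodule.span_mono (Set.image_mono fun _ hk => le_trans hk hij)

theorem component_mem_filtration (i : ℕ) (v : TangentSpace (𝓡 n) q) :
    A.component h i v ∈ A.filtration h i := by
  have h1 : {j | w j = i} ⊆ {j | w j ≤ i} := fun k hk => le_of_eq hk
  exact Submodule.span_mono (Set.image_mono h1) (blockMap_mem_span b w i (A.lieBasis h) v)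

theorem exists_component_eq_lieBasis (j : Fin n) :
    ∃ X ∈ flagFields M.dist (w j), A.component h (w j) (X q) = A.lieBasis h j := by
  obtain ⟨X, hX, hXq⟩ := mem_flag_iff.1 (h.mem j)
  exact ⟨X, hX, by rw [hXq, component, blockMap_basis, if_pos rfl]⟩

/-- Each basis vector of the Lie algebra is the component of a section of the flag, so the claim on
basis vectors comes from brackets of fields on `M`; bilinearity does the rest. -/
theorem lieBilin_mem_filtration {i j : ℕ} {x y : A.lieAlg} (hx : x ∈ A.filtration h i)
    (hy : y ∈ A.filtration h j) : lieBilin x y ∈ A.filtration h (i + j) := by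
  have h1 : ∀ k l, w k ≤ i → w l ≤ j →
      lieBilin (A.lieBasis h k) (A.lieBasis h l) ∈ A.filtration h (i + j) := by
    intro k l hk hl
    obtain ⟨X, hX, hXk⟩ := A.exists_component_eq_lieBasis h k
    obtain ⟨Y, hY, hYl⟩ := A.exists_component_eq_lieBasis h l
    rw [← hXk, ← hYl, ← A.component_mlieBracket h hX hY]
    exact A.filtration_mono h (add_le_add hk hl) (A.component_mem_filtration h _ _)
  have h2 : A.filtration h j ≤
      (A.filtration h (i + j)).comap (lieBilin x) := by
    refine Submodule.span_le.2 ?_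
    rintro _ ⟨l, hl, rfl⟩
    have h3 : A.filtration h i ≤
        (A.filtration h (i + j)).comap (lieBilin.flip (A.lieBasis h l)) := by
      refine Submodule.span_le.2 ?_
      rintro _ ⟨k, hk, rfl⟩
      exact h1 k l hk hl
    exact h3 hx
  exact h2 hy

theorem mem_dist_space_iff (x : A.space.carrier) (u : TangentSpace (𝓡 n) x) :
    u ∈ A.space.dist x ↔ ∃ X : M.horizontal,
      u = mulInvariantVectorField (A.component h 1 (X.1 q)) x := by
  rw [A.dist_eq]
  refine exists_congr fun X => ?_
  rw [A.toLie_symbol h (i := 1) X.2]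

theorem metric_space_eq (x : A.space.carrier) (X Y : M.horizontal) (u v : A.space.dist x)
    (hu : (u : TangentSpace (𝓡 n) x) = mulInvariantVectorField (A.component h 1 (X.1 q)) x)
    (hv : (v : TangentSpace (𝓡 n) x) = mulInvariantVectorField (A.component h 1 (Y.1 q)) x) :
    A.space.metric x u v = M.innerAt q X Y := by
  rw [← A.toLie_symbol h (i := 1) X.2] at hu
  rw [← A.toLie_symbol h (i := 1) Y.2] at hv
  exact A.metric_eq x X Y u v hu hv

theorem mulInvariantVectorField_mem_horizontal (X : M.horizontal) :
    mulInvariantVectorField (A.component h 1 (X.1 q)) ∈ A.space.horizontal :=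
  ⟨smoothField_mulInvariantVectorField _, fun x => (A.mem_dist_space_iff h x _).2 ⟨X, rfl⟩⟩

/-- The bracket of the nilpotent approximation mirrors the bracket of sections, so the construction
of the flag on `M` can be repeated with left-invariant fields. A section of `Dⁱ` regarded in `Dⁱ⁺¹`
has component zero there. -/
theorem mulInvariantVectorField_component_mem {i : ℕ} : ∀ X ∈ flagFields M.dist i,
    mulInvariantVectorField (A.component h i (X q)) ∈ flagFields A.space.dist i := by
  refine flagFields_induction (p := fun i X =>
    mulInvariantVectorField (A.component h i (X q)) ∈ flagFields A.space.dist i)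
    ?_ ?_ ?_ ?_ ?_ ?_
  · intro i
    have h1 : A.component h i ((0 : VField n M.carrier) q) = (0 : ℝ) • 0 := by
      rw [zero_smul]; exact map_zero _
    rw [h1, mulInvariantVectorField_smul, zero_smul]
    exact Submodule.zero_mem _
  · intro i X Y _ _ hX hY
    rw [Pi.add_apply, map_add, mulInvariantVectorField_add]
    exact Submodule.add_mem _ hX hY
  · intro i c X _ hX
    rw [Pi.smul_apply, map_smul, mulInvariantVectorField_smul]
    exact Submodule.smul_mem _ c hX
  · exact fun X hX => A.mulInvariantVectorField_mem_horizontal h ⟨X, hX⟩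
  · intro i X hX _
    have h0 := mem_flag_of_mem_flagFields hX q
    have h1 : A.component h (i + 1) (X q) = (0 : ℝ) • 0 := by
      rw [zero_smul]
      exact (A.component_eq_zero_iff h (flag_mono q (Nat.le_succ i) h0)).2 h0
    rw [h1, mulInvariantVectorField_smul, zero_smul]
    exact Submodule.zero_mem _
  · intro i X hX Y hY ih
    rw [A.component_mlieBracket h (j := 1) hX hY, lieBilin_apply,
      ← mlieBracket_mulInvariantVectorField]
    exact mlieBracket_mem_flagFields (j := 1) ih
      (A.mulInvariantVectorField_mem_horizontal h ⟨Y, hY⟩)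

theorem mulInvariantVectorField_mem_flagFields {i : ℕ} {x : A.lieAlg}
    (hx : x ∈ A.filtration h i) : mulInvariantVectorField x ∈ flagFields A.space.dist i := by
  induction hx using Submodule.span_induction with
  | mem x hx =>
    obtain ⟨j, hj, rfl⟩ := hx
    obtain ⟨X, hX, hXj⟩ := A.exists_component_eq_lieBasis h j
    rw [← hXj]
    exact flagFields_mono (show w j ≤ i from hj) (A.mulInvariantVectorField_component_mem h X hX)
  | zero =>
    have h1 : (0 : A.lieAlg) = (0 : ℝ) • 0 := (zero_smul ℝ _).symm
    rw [h1, mulInvariantVectorField_smul, zero_smul]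
    exact Submodule.zero_mem _
  | add x y _ _ hx hy =>
    rw [mulInvariantVectorField_add]
    exact Submodule.add_mem _ hx hy
  | smul c x _ hx =>
    rw [mulInvariantVectorField_smul]
    exact Submodule.smul_mem _ c hx

theorem coe_filter_weight (i : ℕ) :
    ((Finset.univ.filter fun j => w j ≤ i : Finset (Fin n)) : Set (Fin n)) = {j | w j ≤ i} := by
  ext; simp

theorem trivialize_mlieBracket_sub_mem_filtration {Z Z' : VField n A.space.carrier}
    (hZ : SmoothField Z) (hZ' : SmoothField Z') {i j : ℕ}
    (hI : ∀ g, trivialize Z g ∈ A.filtration h i)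
    (hJ : ∀ g, trivialize Z' g ∈ A.filtration h j) (g : A.space.carrier) :
    trivialize (mlieBracket (𝓡 n) Z Z') g - lieBilin (trivialize Z g) (trivialize Z' g) ∈
      A.filtration h i ⊔ A.filtration h j := by
  have h1 := trivialize_mlieBracket_sub_mem (A.lieBasis h) hZ hZ'
    (I := Finset.univ.filter fun k => w k ≤ i) (J := Finset.univ.filter fun k => w k ≤ j)
    (by rw [coe_filter_weight]; exact hI) (by rw [coe_filter_weight]; exact hJ) g
  rw [coe_filter_weight, coe_filter_weight] at h1
  exact h1

/-- Sections of the flag on the group need not be left-invariant, but the derivatives of their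
coefficients only add terms in the filtration of the two factors, which is contained in that of the
bracket. -/
theorem trivialize_mem_filtration {i : ℕ} : ∀ Z ∈ flagFields A.space.dist i,
    ∀ g, trivialize Z g ∈ A.filtration h i := by
  have horiz : ∀ Z ∈ horizontalFields A.space.dist, ∀ g, trivialize Z g ∈ A.filtration h 1 := by
    intro Z hZ g
    obtain ⟨X, hX⟩ := (A.mem_dist_space_iff h g _).1 (hZ.2 g)
    have h1 : trivialize Z g = A.component h 1 (X.1 q) := by
      rw [← trivialize_mulInvariantVectorField (A.component h 1 (X.1 q)) g, trivialize, hX]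
      rfl
    rw [h1]
    exact A.component_mem_filtration h 1 _
  refine flagFields_induction (p := fun i Z => ∀ g, trivialize Z g ∈ A.filtration h i)
    ?_ ?_ ?_ ?_ ?_ ?_
  · intro i g
    have h1 : trivialize (0 : VField n A.space.carrier) g = 0 := map_zero (mulInvariantEquiv g).symm
    rw [h1]
    exact Submodule.zero_mem _
  · intro i X Y _ _ hX hY g
    have h1 : trivialize (X + Y) g = trivialize X g + trivialize Y g :=
      map_add (mulInvariantEquiv g).symm _ _
    rw [h1]
    exact Submodule.add_mem _ (hX g) (hY g)
  · intro i c X _ hX g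
    have h1 : trivialize (c • X) g = c • trivialize X g :=
      (mulInvariantEquiv g).symm.map_smul c (X g)
    rw [h1]
    exact Submodule.smul_mem _ _ (hX g)
  · exact horiz
  · exact fun i X _ hX g => A.filtration_mono h (Nat.le_succ i) (hX g)
  · intro i X hX Y hY ih g
    have h1 := A.trivialize_mlieBracket_sub_mem_filtration h (smoothField_of_mem_flagFields hX)
      hY.1 ih (horiz Y hY) g
    have h2 : A.filtration h (i + 1) ⊔ A.filtration h 1 ≤ A.filtration h (i + 2) :=
      sup_le (A.filtration_mono h (by omega)) (A.filtration_mono h (by omega))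
    have h3 := Submodule.add_mem _ (h2 h1)
      (A.lieBilin_mem_filtration h (i := i + 1) (j := 1) (ih g) (horiz Y hY g))
    rwa [sub_add_cancel] at h3

theorem flag_space_one (i : ℕ) : A.space.flagAt i 1 = A.filtration h i := by
  ext x
  constructor
  · intro hx
    obtain ⟨Z, hZ, rfl⟩ := mem_flag_iff.1 hx
    rw [← trivialize_one Z]
    exact A.trivialize_mem_filtration h Z hZ 1
  · intro hx
    exact mem_flag_iff.2 ⟨_, A.mulInvariantVectorField_mem_flagFields h hx,
      mulInvariantVectorField_one x⟩

theorem isAdapted_lieBasis : A.space.IsAdapted 1 (A.lieBasis h) w :=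
  ⟨fun j => by rw [A.flag_space_one h]; exact Submodule.subset_span ⟨j, le_refl (w j), rfl⟩,
    fun i => (A.flag_space_one h i).symm⟩

theorem rank_space : A.space.rank = M.rank := by
  obtain ⟨b, w, h⟩ := M.exists_isAdapted q
  have h1 := (M.isAdapted_iff.1 h).card_le_eq 1
  have h2 := (A.space.isAdapted_iff.1 (A.isAdapted_lieBasis h)).card_le_eq 1
  rw [← M.finrank_dist q, ← A.space.finrank_dist 1, ← flag_one, ← flag_one]
  exact h2.symm.trans h1

/-- On the side of `M` there is no error term: the component already discards everything of lower
weight. -/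
theorem component_nestedBracket : ∀ {i : ℕ} (X : Fin i → M.horizontal),
    A.component h i (nestedBracket (List.ofFn fun l => (X l).1) q) =
      nestedLie A.space.carrier i (fun l => A.component h 1 ((X l).1 q)) := by
  intro i
  induction i using Nat.twoStepInduction with
  | zero => intro X; exact map_zero _
  | one => intro X; rfl
  | more i _ ih =>
    intro X
    rw [nestedLie_succ, ← ih fun l => X l.succ]
    have h1 := A.component_mlieBracket h (i := 1) (j := i + 1) (X 0).2
      (nestedBracket_mem_flagFields (fun l : Fin (i + 1) => (X l.succ).1) fun l => (X l.succ).2)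
    rw [show 1 + (i + 1) = i + 2 by omega] at h1
    rw [List.ofFn_succ] at h1 ⊢
    rw [List.ofFn_succ]
    exact h1

/-- On the group the bracket of horizontal fields differs from the Lie bracket of their values by
derivatives of coefficients. These have lower weight, so they disappear in the quotient that defines
Popp's norm. -/
theorem nestedBracket_sub_nestedLie_mem : ∀ {i : ℕ} (Z : Fin i → A.space.horizontal),
    nestedBracket (List.ofFn fun l => (Z l).1) 1 -
      nestedLie A.space.carrier i (fun l => (Z l).1 1) ∈ A.filtration h (i - 1) := by
  intro i
  induction i using Nat.twoStepInduction with
  | zero =>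
    intro Z
    rw [nestedLie_zero]
    have : nestedBracket (List.ofFn fun l => (Z l).1) 1 = 0 := rfl
    rw [this, sub_zero]
    exact Submodule.zero_mem _
  | one =>
    intro Z
    have : nestedBracket (List.ofFn fun l => (Z l).1) 1 = (Z 0).1 1 := rfl
    rw [this, nestedLie_one, sub_self]
    exact Submodule.zero_mem _
  | more i _ ih =>
    intro Z
    set W := nestedBracket (List.ofFn fun l : Fin (i + 1) => (Z l.succ).1) with hW
    have hWm : W ∈ flagFields A.space.dist (i + 1) :=
      nestedBracket_mem_flagFields _ fun l => (Z l.succ).2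
    have e : nestedBracket (List.ofFn fun l => (Z l).1) = mlieBracket (𝓡 n) (Z 0).1 W := by
      rw [hW, List.ofFn_succ, List.ofFn_succ]
      rfl
    have h0 : ∀ g, trivialize (Z 0).1 g ∈ A.filtration h 1 :=
      A.trivialize_mem_filtration h (i := 1) _ (Z 0).2
    have h1 := A.trivialize_mlieBracket_sub_mem_filtration h (Z 0).2.1
      (smoothField_of_mem_flagFields hWm) h0 (A.trivialize_mem_filtration h W hWm) 1
    -- Both factors have weight at most `i + 1`, one less than the total weight `i + 2`, so the
    -- derivative terms are within the admitted error.
    have h2 : A.filtration h 1 ⊔ A.filtration h (i + 1) ≤ A.filtration h (i + 1) :=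
      sup_le (A.filtration_mono h (by omega)) le_rfl
    have h3 := A.lieBilin_mem_filtration h (h0 1) (ih fun l => Z l.succ)
    rw [show 1 + (i + 1 - 1) = i + 1 by omega] at h3
    have h4 := Submodule.add_mem _ (h2 h1) h3
    rw [trivialize_one, trivialize_one, trivialize_one, map_sub] at h4
    rw [e, nestedLie_succ]
    rwa [sub_add_sub_cancel] at h4

end NilpotentApproximation

end OrientedStructure

/-! ### Orthonormal bases, quotient norms and tensor powers -/

section InnerProducts

theorem exists_orthonormal_basis_of_posDef {V : Type*} [AddCommGroup V] [Module ℝ V]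
    [FiniteDimensional ℝ V] (B : LinearMap.BilinForm ℝ V) (hs : ∀ v w, B v w = B w v)
    (hp : ∀ v, v ≠ 0 → 0 < B v v) {k : ℕ} (hk : Module.finrank ℝ V = k) :
    ∃ e : Module.Basis (Fin k) ℝ V, ∀ i j, B (e i) (e j) = if i = j then 1 else 0 := by
  let core : InnerProductSpace.Core ℝ V :=
    { inner := fun v w => B v w
      conj_inner_symm := fun v w => by simpa using hs w v
      re_inner_nonneg := fun v => by
        by_cases hv : v = 0
        · simp [hv]
        · simpa using (hp v hv).le
      add_left := fun u v w => by simp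
      smul_left := fun u v c => by simp
      definite := fun v hv => by
        by_contra h
        exact (hp v h).ne' hv }
  let _ : NormedAddCommGroup V := core.toNormedAddCommGroup
  let _ : InnerProductSpace ℝ V := InnerProductSpace.ofCore core.toCore
  let o : OrthonormalBasis (Fin k) ℝ V := (stdOrthonormalBasis ℝ V).reindex (finCongr hk)
  refine ⟨o.toBasis, fun i j => ?_⟩
  rw [o.coe_toBasis]
  exact orthonormal_iff_ite.1 o.orthonormal i j

/-- The images of the vectors of an orthonormal basis of the orthogonal complement of the kernel
are orthonormal for the quotient norm. -/
theorem exists_orthonormal_images {W V ι : Type*} [NormedAddCommGroup W] [InnerProductSpace ℝ W]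
    [FiniteDimensional ℝ W] [AddCommGroup V] [Module ℝ V] [Fintype ι] (L : W →ₗ[ℝ] V)
    (hc : Module.finrank ℝ (LinearMap.range L) = Fintype.card ι) :
    ∃ u : ι → V, Submodule.span ℝ (Set.range u) = LinearMap.range L ∧
      ∀ t : ι → ℝ, sInf {s | ∃ a : W, L a = ∑ j, t j • u j ∧ s = ‖a‖ ^ 2} = ∑ j, t j ^ 2 := by
  have h1 : Module.finrank ℝ (LinearMap.ker L)ᗮ = Fintype.card ι := by
    have h2 := (LinearMap.ker L).finrank_add_finrank_orthogonal
    have h3 := L.finrank_range_add_finrank_ker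
    omega
  let o : OrthonormalBasis ι ℝ (LinearMap.ker L)ᗮ :=
    (stdOrthonormalBasis ℝ _).reindex (Fintype.equivOfCardEq (by simp [h1]))
  refine ⟨fun j => L (o j), ?_, fun t => ?_⟩
  · have h2 : Set.range (fun j => L (o j)) =
        (L ∘ₗ (LinearMap.ker L)ᗮ.subtype) '' Set.range o := by
      rw [← Set.range_comp]
      rfl
    rw [h2, Submodule.span_image, ← o.coe_toBasis, o.toBasis.span_eq, Submodule.map_top,
      LinearMap.range_comp, Submodule.range_subtype]
    refine le_antisymm (LinearMap.map_le_range) ?_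
    rintro _ ⟨a, rfl⟩
    obtain ⟨y, hy, z, hz, rfl⟩ := (LinearMap.ker L).exists_add_mem_mem_orthogonal a
    rw [map_add, LinearMap.mem_ker.1 hy, zero_add]
    exact ⟨z, hz, rfl⟩
  · set x : (LinearMap.ker L)ᗮ := ∑ j, t j • o j with hx
    have hLx : L x = ∑ j, t j • L (o j) := by
      rw [hx]
      simp
    have hnx : ‖(x : W)‖ ^ 2 = ∑ j, t j ^ 2 := by
      have h4 := o.sum_sq_norm_inner_right x
      have h5 : ∀ j, inner ℝ (o j) x = t j := fun j => by
        rw [hx]; exact o.orthonormal.inner_right_fintype t j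
      simp only [h5, Real.norm_eq_abs, sq_abs] at h4
      rw [h4]; rfl
    -- The preimage orthogonal to the kernel has least norm: any other one differs from it by a
    -- vector of the kernel, and Pythagoras applies.
    refine IsLeast.csInf_eq ⟨⟨x, hLx, hnx.symm⟩, ?_⟩
    rintro _ ⟨a, ha, rfl⟩
    have hker : a - x ∈ LinearMap.ker L := by
      rw [LinearMap.mem_ker, map_sub, ha, hLx, sub_self]
    have h6 : inner ℝ (a - x) (x : W) = 0 :=
      (LinearMap.ker L).inner_right_of_mem_orthogonal hker x.2
    have h7 := norm_add_sq_real (a - x) (x : W)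
    rw [h6, sub_add_cancel, hnx] at h7
    have h8 := sq_nonneg ‖a - x‖
    linarith

/-- A tensor power of an orthogonal matrix is orthogonal: the inner product of two of its rows is
the product over the factors of inner products of rows of `O`. -/
theorem sum_sq_sum_mul_prod {k i : ℕ} (O : Fin k → Fin k → ℝ)
    (hO : ∀ j j', ∑ m, O j m * O j' m = if j = j' then 1 else 0) (a : (Fin i → Fin k) → ℝ) :
    ∑ J : Fin i → Fin k, (∑ I : Fin i → Fin k, a I * ∏ l, O (I l) (J l)) ^ 2 = ∑ I, a I ^ 2 := by
  have h1 : ∀ I I' : Fin i → Fin k,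
      ∑ J : Fin i → Fin k, (∏ l, O (I l) (J l)) * ∏ l, O (I' l) (J l) =
      if I = I' then 1 else 0 := by
    intro I I'
    simp only [← Finset.prod_mul_distrib]
    have h2 := Finset.prod_univ_sum (fun _ : Fin i => (Finset.univ : Finset (Fin k)))
      (fun l m => O (I l) m * O (I' l) m)
    rw [Fintype.piFinset_univ] at h2
    rw [← h2]
    simp only [hO]
    by_cases h : I = I'
    · simp [h]
    · rw [if_neg h]
      obtain ⟨l, hl⟩ := Function.ne_iff.1 h
      exact Finset.prod_eq_zero (Finset.mem_univ l) (if_neg hl)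
  calc ∑ J : Fin i → Fin k, (∑ I : Fin i → Fin k, a I * ∏ l, O (I l) (J l)) ^ 2
      = ∑ J : Fin i → Fin k, ∑ I : Fin i → Fin k, ∑ I' : Fin i → Fin k,
        a I * a I' * ((∏ l, O (I l) (J l)) * ∏ l, O (I' l) (J l)) := by
        refine Finset.sum_congr rfl fun J _ => ?_
        rw [sq, Finset.sum_mul_sum]
        exact Finset.sum_congr rfl fun I _ => Finset.sum_congr rfl fun I' _ => by ring
    _ = ∑ I : Fin i → Fin k, ∑ I' : Fin i → Fin k,
        a I * a I' * ∑ J : Fin i → Fin k, (∏ l, O (I l) (J l)) * ∏ l, O (I' l) (J l) := by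
        rw [Finset.sum_comm]
        refine Finset.sum_congr rfl fun I _ => ?_
        rw [Finset.sum_comm]
        exact Finset.sum_congr rfl fun I' _ => by rw [Finset.mul_sum]
    _ = ∑ I, a I ^ 2 := by
        simp only [h1]
        refine Finset.sum_congr rfl fun I _ => ?_
        simp [sq]

end InnerProducts

/-! ### Popp's norm and the determinants between Popp bases -/

namespace OrientedStructure

variable {n : ℕ} {M N : OrientedStructure n} {q : M.carrier}

/-- The set of the square norms of the tensors that represent the class of `v`. -/
def poppSet (M : OrientedStructure n) (k : ℕ) (q : M.carrier) (i : ℕ)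
    (v : TangentSpace (𝓡 n) q) : Set ℝ :=
  {s | ∃ (E : Fin k → M.horizontal) (a : (Fin i → Fin k) → ℝ),
    (∀ j l, M.innerAt q (E j) (E l) = if j = l then 1 else 0) ∧
    v - ∑ I, a I • nestedBracket (List.ofFn fun l => (E (I l)).1) q ∈ M.flagAt (i - 1) q ∧
    s = ∑ I, a I ^ 2}

/-- In `poppSet` the number of fields is a free variable, so that the equality of the ranks of two
structures can be used by rewriting. -/
theorem poppNormSq_eq (M : OrientedStructure n) (q : M.carrier) (i : ℕ)
    (v : TangentSpace (𝓡 n) q) : M.poppNormSq q i v = sInf (M.poppSet M.rank q i v) := rfl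

theorem poppNormSq_congr {i : ℕ} {u v : TangentSpace (𝓡 n) q} (h : u - v ∈ M.flagAt (i - 1) q) :
    M.poppNormSq q i u = M.poppNormSq q i v := by
  have h1 : ∀ z, u - z ∈ M.flagAt (i - 1) q ↔ v - z ∈ M.flagAt (i - 1) q := by
    intro z
    rw [← Submodule.add_mem_iff_right (M.flagAt (i - 1) q) h (y := v - z), sub_add_sub_cancel]
  simp only [poppNormSq, h1]

theorem IsPoppBasis.abs_det_eq_one {b b' : Module.Basis (Fin n) ℝ (TangentSpace (𝓡 n) q)}
    (h : M.IsPoppBasis q b) (h' : M.IsPoppBasis q b') : |b.det b'| = 1 := by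
  obtain ⟨w, hw, hb⟩ := h
  obtain ⟨w', hw', hb'⟩ := h'
  exact AdaptedBasis.abs_det_eq_one (F := fun i => M.flagAt i q) (flag_zero q)
    (M.isAdapted_iff.1 hw) (M.isAdapted_iff.1 hw') (M.poppNormSq q)
    (fun i u v huv => poppNormSq_congr huv) hb hb'

/-! ### Invariance under isometries -/

section Isometry

variable {φ : M.carrier ≃ₘ^∞⟮𝓡 n, 𝓡 n⟯ N.carrier}

/-- The image of a horizontal field under an isometry. -/
def IsIsometry.pushHorizontal (h : IsIsometry M N φ) (X : M.horizontal) : N.horizontal :=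
  ⟨pushField φ X.1, h.pushField_mem X.2⟩

theorem IsIsometry.innerAt_pushHorizontal (h : IsIsometry M N φ) (X Y : M.horizontal)
    (q : M.carrier) :
    N.innerAt (φ q) (h.pushHorizontal X) (h.pushHorizontal Y) = M.innerAt q X Y :=
  h.map_metric q _ _ _ _ (pushField_apply φ X.1 q) (pushField_apply φ Y.1 q)

theorem IsIsometry.pushField_nestedBracket (h : IsIsometry M N φ) : ∀ {i : ℕ}
    (X : Fin i → M.horizontal), pushField φ (nestedBracket (List.ofFn fun l => (X l).1)) =
      nestedBracket (List.ofFn fun l => (h.pushHorizontal (X l)).1) := by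
  intro i
  induction i using Nat.twoStepInduction with
  | zero => intro X; exact mpullback_zero ..
  | one => intro X; rfl
  | more i _ ih =>
    intro X
    have h1 := ih fun l => X l.succ
    have h2 : SmoothField (nestedBracket (List.ofFn fun l : Fin (i + 1) => (X l.succ).1)) :=
      smoothField_of_mem_flagFields
        (nestedBracket_mem_flagFields _ fun l => (X l.succ).2)
    rw [List.ofFn_succ] at h1 h2 ⊢
    conv_rhs at h1 => rw [List.ofFn_succ]
    conv_rhs => rw [List.ofFn_succ]
    rw [List.ofFn_succ]
    conv_rhs => rw [List.ofFn_succ]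
    rw [nestedBracket, nestedBracket, ← h1]
    exact pushField_mlieBracket φ (X 0).2.1 h2

theorem IsIsometry.map_mem_flag (h : IsIsometry M N φ) {i : ℕ} {v : TangentSpace (𝓡 n) q}
    (hv : v ∈ M.flagAt i q) : mfderiv (𝓡 n) (𝓡 n) φ q v ∈ N.flagAt i (φ q) := by
  obtain ⟨X, hX, rfl⟩ := mem_flag_iff.1 hv
  exact mem_flag_iff.2 ⟨_, h.pushField_mem_flagFields X hX, pushField_apply φ X q⟩

theorem IsIsometry.map_mem_flag_iff (h : IsIsometry M N φ) {i : ℕ} {v : TangentSpace (𝓡 n) q} :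
    mfderiv (𝓡 n) (𝓡 n) φ q v ∈ N.flagAt i (φ q) ↔ v ∈ M.flagAt i q := by
  refine ⟨fun hv => ?_, h.map_mem_flag⟩
  have h1 := h.symm.map_mem_flag hv
  rw [mfderiv_symm_comp] at h1
  have h2 : ∀ p, p = q → (v : EuclideanSpace ℝ (Fin n)) ∈
      (M.flagAt i p : Submodule ℝ (EuclideanSpace ℝ (Fin n))) → v ∈ M.flagAt i q := by
    rintro p rfl h3
    exact h3
  exact h2 _ (φ.symm_apply_apply q) h1

theorem IsIsometry.poppSet_subset (h : IsIsometry M N φ) (k i : ℕ) (v : TangentSpace (𝓡 n) q) :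
    M.poppSet k q i v ⊆ N.poppSet k (φ q) i (mfderiv (𝓡 n) (𝓡 n) φ q v) := by
  rintro _ ⟨E, a, hE, hv, rfl⟩
  refine ⟨fun j => h.pushHorizontal (E j), a, fun j l => ?_, ?_, rfl⟩
  · rw [h.innerAt_pushHorizontal, hE]
  · have h1 := h.map_mem_flag hv
    rw [map_sub, map_sum] at h1
    convert h1 using 3
    rw [map_smul, ← h.pushField_nestedBracket, pushField_apply]

theorem IsIsometry.poppNormSq_eq (h : IsIsometry M N φ) (i : ℕ) (v : TangentSpace (𝓡 n) q) :
    N.poppNormSq (φ q) i (mfderiv (𝓡 n) (𝓡 n) φ q v) = M.poppNormSq q i v := by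
  rw [OrientedStructure.poppNormSq_eq, OrientedStructure.poppNormSq_eq, h.rank_eq]
  congr 1
  refine Set.Subset.antisymm ?_ (h.poppSet_subset _ _ v)
  have h1 := h.symm.poppSet_subset M.rank i (mfderiv (𝓡 n) (𝓡 n) φ q v)
  rw [mfderiv_symm_comp] at h1
  have h2 : ∀ p, p = q → ∀ S : Set ℝ, S ⊆ M.poppSet M.rank p i (v : EuclideanSpace ℝ (Fin n)) →
      S ⊆ M.poppSet M.rank q i v := by
    rintro p rfl S h3
    exact h3
  exact h2 _ (φ.symm_apply_apply q) _ h1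

theorem IsIsometry.isPoppBasis (h : IsIsometry M N φ)
    {b : Module.Basis (Fin n) ℝ (TangentSpace (𝓡 n) q)} (hb : M.IsPoppBasis q b) :
    N.IsPoppBasis (φ q) (b.map (tangentEquiv φ q).toLinearEquiv) := by
  obtain ⟨w, hw, ht⟩ := hb
  have e : ∀ v, (tangentEquiv φ q).toLinearEquiv v = mfderiv (𝓡 n) (𝓡 n) φ q v := fun _ => rfl
  refine ⟨w, ⟨fun j => ?_, fun i => ?_⟩, fun i t => ?_⟩
  · rw [Module.Basis.map_apply, e]
    exact h.map_mem_flag (hw.mem j)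
  · have h1 : ⇑(b.map (tangentEquiv φ q).toLinearEquiv) '' {j | w j ≤ i} =
        (tangentEquiv φ q).toLinearEquiv '' (b '' {j | w j ≤ i}) := by
      rw [← Set.image_comp]
      rfl
    rw [h1]
    refine (Submodule.map_span (tangentEquiv φ q).toLinearEquiv.toLinearMap _).symm.trans ?_
    rw [hw.span]
    ext x
    constructor
    · rintro ⟨v, hv, rfl⟩
      exact h.map_mem_flag hv
    · intro hx
      refine ⟨(tangentEquiv φ q).symm x, ?_, (tangentEquiv φ q).apply_symm_apply x⟩
      rw [← (tangentEquiv φ q).apply_symm_apply x] at hx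
      exact h.map_mem_flag_iff.1 hx
  · rw [← ht, ← h.poppNormSq_eq, map_sum]
    simp only [map_smul]
    rfl

end Isometry

/-! ### Popp's norm on the nilpotent approximation -/

namespace NilpotentApproximation

variable (A : M.NilpotentApproximation q) {b : Module.Basis (Fin n) ℝ (TangentSpace (𝓡 n) q)}
  {w : Fin n → ℕ} (h : M.IsAdapted q b w)

/-- A component of weight `i` is a combination of basis vectors of weight exactly `i`, so it can lie
in the lower filtration only by vanishing. -/
theorem component_mem_filtration_pred_iff (i : ℕ) (v : TangentSpace (𝓡 n) q) :
    A.component h i v ∈ A.filtration h (i - 1) ↔ A.component h i v = 0 := by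
  refine ⟨fun h1 => ?_, fun h1 => h1 ▸ Submodule.zero_mem _⟩
  have hA : AdaptedBasis (fun i => A.space.flagAt i 1) (A.lieBasis h) w :=
    A.space.isAdapted_iff.1 (A.isAdapted_lieBasis h)
  rw [← A.flag_space_one h] at h1
  have h2 := A.component_mem_filtration h i v
  rw [← A.flag_space_one h] at h2
  rw [hA.mem_pred_iff (flag_zero _) i _ h2] at h1
  have h3 : A.component h i v ∈ Submodule.span ℝ (A.lieBasis h '' {j | w j = i}) :=
    blockMap_mem_span _ _ _ _ _
  rw [Module.Basis.mem_span_image] at h3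
  refine (A.lieBasis h).repr.map_eq_zero_iff.1 (Finsupp.ext fun j => ?_)
  by_contra h4
  exact h4 (h1 j (h3 (Finsupp.mem_support_iff.2 h4)))

theorem sub_mem_flag_iff {i k : ℕ} {v : TangentSpace (𝓡 n) q} (hv : v ∈ M.flagAt i q)
    (E : Fin k → M.horizontal) (a : (Fin i → Fin k) → ℝ) :
    v - ∑ I, a I • nestedBracket (List.ofFn fun l => (E (I l)).1) q ∈ M.flagAt (i - 1) q ↔
      A.component h i v = ∑ I, a I •
        nestedLie A.space.carrier i (fun l => A.component h 1 ((E (I l)).1 q)) := by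
  have h1 : v - ∑ I, a I • nestedBracket (List.ofFn fun l => (E (I l)).1) q ∈ M.flagAt i q :=
    Submodule.sub_mem _ hv (Submodule.sum_mem _ fun I _ => Submodule.smul_mem _ _
      (mem_flag_of_mem_flagFields (nestedBracket_mem_flagFields _ fun l => (E (I l)).2) q))
  rw [← A.component_eq_zero_iff h h1, map_sub, sub_eq_zero, map_sum]
  simp only [map_smul]
  rw [Finset.sum_congr rfl fun I _ => by rw [A.component_nestedBracket h fun l => E (I l)]]

/-- The right-hand side is the same equation as in `sub_mem_flag_iff`. Hence a tensor represents a
class on `M` exactly when it represents the corresponding class on the group. -/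
theorem sub_mem_flag_space_iff {i k : ℕ} {v : TangentSpace (𝓡 n) q}
    (E : Fin k → M.horizontal) (Z : Fin k → A.space.horizontal)
    (hZ : ∀ j, (Z j).1 1 = A.component h 1 ((E j).1 q)) (a : (Fin i → Fin k) → ℝ) :
    A.component h i v - ∑ I, a I • nestedBracket (List.ofFn fun l => (Z (I l)).1) 1 ∈
        A.space.flagAt (i - 1) 1 ↔
      A.component h i v = ∑ I, a I •
        nestedLie A.space.carrier i (fun l => A.component h 1 ((E (I l)).1 q)) := by
  rw [A.flag_space_one h]
  have h1 : ∑ I, a I • nestedLie A.space.carrier i (fun l => A.component h 1 ((E (I l)).1 q)) =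
      A.component h i (∑ I, a I • nestedBracket (List.ofFn fun l => (E (I l)).1) q) := by
    rw [map_sum]
    refine Finset.sum_congr rfl fun I _ => ?_
    rw [map_smul, A.component_nestedBracket h fun l => E (I l)]
  have h2 : ∑ I, a I • nestedBracket (List.ofFn fun l => (Z (I l)).1) 1 -
      ∑ I, a I • nestedLie A.space.carrier i (fun l => A.component h 1 ((E (I l)).1 q)) ∈
      A.filtration h (i - 1) := by
    rw [← Finset.sum_sub_distrib]
    refine Submodule.sum_mem _ fun I _ => ?_
    rw [← smul_sub]
    have h3 := A.nestedBracket_sub_nestedLie_mem h fun l => Z (I l)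
    simp only [hZ] at h3
    exact Submodule.smul_mem _ _ h3
  rw [← Submodule.add_mem_iff_left _ h2, sub_add_sub_cancel, h1, ← map_sub,
    A.component_mem_filtration_pred_iff h, map_sub, sub_eq_zero]

theorem poppSet_space_eq (k : ℕ) {i : ℕ} {v : TangentSpace (𝓡 n) q} (hv : v ∈ M.flagAt i q) :
    A.space.poppSet k 1 i (A.component h i v) = M.poppSet k q i v := by
  have hinner : ∀ (X Y : M.horizontal) (Z W : A.space.horizontal),
      Z.1 1 = A.component h 1 (X.1 q) → W.1 1 = A.component h 1 (Y.1 q) →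
      A.space.innerAt 1 Z W = M.innerAt q X Y := by
    intro X Y Z W hZ hW
    refine A.metric_space_eq h 1 X Y _ _ ?_ ?_
    · rw [mulInvariantVectorField_one]; exact hZ
    · rw [mulInvariantVectorField_one]; exact hW
  ext s
  constructor
  · rintro ⟨Z, a, hZ, hs, rfl⟩
    have h1 : ∀ j, ∃ X : M.horizontal, (Z j).1 1 = A.component h 1 (X.1 q) := by
      intro j
      obtain ⟨X, hX⟩ := (A.mem_dist_space_iff h 1 _).1 ((Z j).2.2 1)
      exact ⟨X, by rw [hX, mulInvariantVectorField_one]⟩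
    choose E hE using h1
    refine ⟨E, a, fun j l => ?_, ?_, rfl⟩
    · rw [← hinner _ _ _ _ (hE j) (hE l), hZ]
    · rw [A.sub_mem_flag_iff h hv]
      exact (A.sub_mem_flag_space_iff h E Z hE a).1 hs
  · rintro ⟨E, a, hE, hs, rfl⟩
    let Z : Fin k → A.space.horizontal := fun j =>
      ⟨_, A.mulInvariantVectorField_mem_horizontal h (E j)⟩
    have hZ : ∀ j, (Z j).1 1 = A.component h 1 ((E j).1 q) := fun j =>
      mulInvariantVectorField_one _
    refine ⟨Z, a, fun j l => ?_, ?_, rfl⟩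
    · rw [hinner _ _ _ _ (hZ j) (hZ l), hE]
    · rw [A.sub_mem_flag_space_iff h E Z hZ]
      exact (A.sub_mem_flag_iff h hv E a).1 hs

theorem poppNormSq_space_eq {i : ℕ} {v : TangentSpace (𝓡 n) q} (hv : v ∈ M.flagAt i q) :
    A.space.poppNormSq 1 i (A.component h i v) = M.poppNormSq q i v := by
  rw [poppNormSq_eq, poppNormSq_eq, A.rank_space, A.poppSet_space_eq h _ hv]

theorem component_sum (i : ℕ) (t : Fin n → ℝ) :
    A.component h i (∑ j with w j = i, t j • b j) = ∑ j with w j = i, t j • A.lieBasis h j := by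
  rw [map_sum]
  refine Finset.sum_congr rfl fun j hj => ?_
  rw [map_smul, component, blockMap_basis, if_pos (Finset.mem_filter.1 hj).2]

theorem _root_.OrientedStructure.IsAdapted.sum_mem_flag (h : M.IsAdapted q b w) (i : ℕ)
    (t : Fin n → ℝ) : ∑ j with w j = i, t j • b j ∈ M.flagAt i q :=
  Submodule.sum_mem _ fun j hj => Submodule.smul_mem _ _ ((Finset.mem_filter.1 hj).2 ▸ h.mem j)

theorem isPoppBasis_lieBasis
    (ht : ∀ (i : ℕ) (t : Fin n → ℝ),
      M.poppNormSq q i (∑ j with w j = i, t j • b j) = ∑ j with w j = i, t j ^ 2) :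
    A.space.IsPoppBasis 1 (A.lieBasis h) := by
  refine ⟨w, A.isAdapted_lieBasis h, fun i t => ?_⟩
  rw [← A.component_sum h, A.poppNormSq_space_eq h (h.sum_mem_flag i t), ht]

end NilpotentApproximation

end OrientedStructure

/-! ### Popp's norm in a fixed frame and the existence of Popp bases -/

namespace OrientedStructure

variable {n : ℕ} {M N : OrientedStructure n} {q : M.carrier}

/-- A horizontal orthonormal frame at a point. -/
theorem exists_orthonormal_frame (M : OrientedStructure n) (q : M.carrier) :
    ∃ (e : Module.Basis (Fin M.rank) ℝ (M.dist q)) (E : Fin M.rank → M.horizontal),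
      (∀ j, (E j).1 q = e j) ∧
      ∀ j l, M.innerAt q (E j) (E l) = if j = l then 1 else 0 := by
  obtain ⟨e, he⟩ := exists_orthonormal_basis_of_posDef (M.metric q) (M.metric_symm q)
    (M.metric_pos q) (M.finrank_dist q)
  choose E hE using fun j => M.mem_dist_iff.1 (e j).2
  refine ⟨e, E, hE, fun j l => ?_⟩
  rw [← he j l]
  have h1 : ∀ j, (⟨(E j).1 q, (E j).2.2 q⟩ : M.dist q) = e j := fun j => Subtype.ext (hE j)
  simp only [innerAt, h1]

namespace NilpotentApproximation

variable (A : M.NilpotentApproximation q) {b : Module.Basis (Fin n) ℝ (TangentSpace (𝓡 n) q)}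
  {w : Fin n → ℕ} (h : M.IsAdapted q b w)

section Frame

variable {k : ℕ} (E : Fin k → M.horizontal)

/-- The tensors, with coordinates in a horizontal frame, are mapped to the Lie algebra by iterated
brackets. -/
def tensorMap (i : ℕ) : EuclideanSpace ℝ (Fin i → Fin k) →ₗ[ℝ] A.lieAlg :=
  ∑ I : Fin i → Fin k, (EuclideanSpace.proj I : _ →L[ℝ] ℝ).toLinearMap.smulRight
    (nestedLie A.space.carrier i fun l => A.component h 1 ((E (I l)).1 q))

theorem tensorMap_apply (i : ℕ) (a : EuclideanSpace ℝ (Fin i → Fin k)) :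
    A.tensorMap h E i a = ∑ I, a I •
      nestedLie A.space.carrier i (fun l => A.component h 1 ((E (I l)).1 q)) := by
  simp [tensorMap, LinearMap.sum_apply]

theorem range_tensorMap_le (i : ℕ) :
    LinearMap.range (A.tensorMap h E i) ≤ Submodule.span ℝ (A.lieBasis h '' {j | w j = i}) := by
  rintro _ ⟨a, rfl⟩
  rw [tensorMap_apply]
  refine Submodule.sum_mem _ fun I _ => Submodule.smul_mem _ _ ?_
  rw [← A.component_nestedBracket h fun l => E (I l)]
  exact blockMap_mem_span _ _ _ _ _

theorem nestedLie_mem_range_tensorMap (i : ℕ) (I : Fin i → Fin k) :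
    nestedLie A.space.carrier i (fun l => A.component h 1 ((E (I l)).1 q)) ∈
      LinearMap.range (A.tensorMap h E i) := by
  classical
  refine ⟨EuclideanSpace.single I 1, ?_⟩
  rw [tensorMap_apply, Finset.sum_eq_single I]
  · simp
  · intro J _ hJ
    simp [hJ]
  · simp

theorem lieBilin_mem_range_tensorMap {i : ℕ} {x y : A.lieAlg}
    (hx : x ∈ Submodule.span ℝ (Set.range fun m => A.component h 1 ((E m).1 q)))
    (hy : y ∈ LinearMap.range (A.tensorMap h E (i + 1))) :
    lieBilin x y ∈ LinearMap.range (A.tensorMap h E (i + 2)) := by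
  have h1 : Submodule.span ℝ (Set.range fun m => A.component h 1 ((E m).1 q)) ≤
      (LinearMap.range (A.tensorMap h E (i + 2))).comap (lieBilin.flip y) := by
    refine Submodule.span_le.2 ?_
    rintro _ ⟨m, rfl⟩
    obtain ⟨a, rfl⟩ := hy
    rw [SetLike.mem_coe, Submodule.mem_comap, LinearMap.flip_apply, tensorMap_apply, map_sum]
    refine Submodule.sum_mem _ fun I _ => ?_
    rw [map_smul]
    refine Submodule.smul_mem _ _ ?_
    exact A.nestedLie_mem_range_tensorMap h E (i + 2) (Fin.cons m I)
  exact h1 hx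

/-- Modulo lower weight, sections of `Dⁱ` are combinations of iterated brackets of the frame. The
flag adds a horizontal field on the right and `nestedLie` adds one on the left, so antisymmetry is
used at each step. -/
theorem component_mem_range_tensorMap
    (hE : ∀ X : M.horizontal, X.1 q ∈ Submodule.span ℝ (Set.range fun m => (E m).1 q)) {i : ℕ} :
    ∀ X ∈ flagFields M.dist i,
      A.component h i (X q) ∈ LinearMap.range (A.tensorMap h E i) := by
  have hspan : ∀ X : M.horizontal, A.component h 1 (X.1 q) ∈
      Submodule.span ℝ (Set.range fun m => A.component h 1 ((E m).1 q)) := by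
    intro X
    have h1 := Submodule.mem_map_of_mem (f := A.component h 1) (hE X)
    rw [Submodule.map_span, ← Set.range_comp] at h1
    exact h1
  refine flagFields_induction (p := fun i X =>
    A.component h i (X q) ∈ LinearMap.range (A.tensorMap h E i)) ?_ ?_ ?_ ?_ ?_ ?_
  · intro i
    have h1 : A.component h i ((0 : VField n M.carrier) q) = 0 := map_zero _
    rw [h1]
    exact Submodule.zero_mem _
  · intro i X Y _ _ hX hY
    rw [Pi.add_apply, map_add]
    exact Submodule.add_mem _ hX hY
  · intro i c X _ hX
    rw [Pi.smul_apply, map_smul]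
    exact Submodule.smul_mem _ c hX
  · intro X hX
    refine (Submodule.span_le.2 ?_) (hspan ⟨X, hX⟩)
    rintro _ ⟨m, rfl⟩
    exact A.nestedLie_mem_range_tensorMap h E 1 fun _ => m
  · intro i X hX _
    have h0 := mem_flag_of_mem_flagFields hX q
    rw [(A.component_eq_zero_iff h (flag_mono q (Nat.le_succ i) h0)).2 h0]
    exact Submodule.zero_mem _
  · intro i X hX Y hY ih
    rw [A.component_mlieBracket h (j := 1) hX hY, lieBilin_swap]
    exact Submodule.neg_mem _ (A.lieBilin_mem_range_tensorMap h E (hspan ⟨Y, hY⟩) ih)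

theorem range_tensorMap
    (hE : ∀ X : M.horizontal, X.1 q ∈ Submodule.span ℝ (Set.range fun m => (E m).1 q)) (i : ℕ) :
    LinearMap.range (A.tensorMap h E i) = Submodule.span ℝ (A.lieBasis h '' {j | w j = i}) := by
  refine le_antisymm (A.range_tensorMap_le h E i) (Submodule.span_le.2 ?_)
  rintro _ ⟨j, rfl, rfl⟩
  obtain ⟨X, hX, hXj⟩ := A.exists_component_eq_lieBasis h j
  rw [← hXj]
  exact A.component_mem_range_tensorMap h E hE X hX

/-- Popp's norm can be computed in a fixed orthonormal frame. -/
theorem poppSet_eq {e : Module.Basis (Fin k) ℝ (M.dist q)} (he : ∀ j, (E j).1 q = e j)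
    (ho : ∀ j l, M.innerAt q (E j) (E l) = if j = l then 1 else 0) {i : ℕ}
    {v : TangentSpace (𝓡 n) q} (hv : v ∈ M.flagAt i q) :
    M.poppSet k q i v = {s | ∃ a : EuclideanSpace ℝ (Fin i → Fin k),
      A.tensorMap h E i a = A.component h i v ∧ s = ‖a‖ ^ 2} := by
  ext s
  constructor
  · rintro ⟨F, a, hF, hs, rfl⟩
    rw [A.sub_mem_flag_iff h hv] at hs
    -- The matrix of the frame `F` in the basis `e`; both being orthonormal, its rows are
    -- orthonormal.
    let O : Fin k → Fin k → ℝ := fun j m => e.repr ⟨(F j).1 q, (F j).2.2 q⟩ m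
    have hFO : ∀ j, (F j).1 q = ∑ m, O j m • (E m).1 q := by
      intro j
      have h1 := congrArg Subtype.val (e.sum_repr ⟨(F j).1 q, (F j).2.2 q⟩)
      refine h1.symm.trans ?_
      rw [Submodule.coe_sum]
      exact Finset.sum_congr rfl fun m _ => by rw [Submodule.coe_smul, he]
    have hin : ∀ m m', M.metric q (e m) (e m') = if m = m' then 1 else 0 := by
      intro m m'
      have h1 : ∀ j, (⟨(E j).1 q, (E j).2.2 q⟩ : M.dist q) = e j := fun j => Subtype.ext (he j)
      rw [← ho m m', innerAt, h1, h1]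
    have hrepr : ∀ j, (⟨(F j).1 q, (F j).2.2 q⟩ : M.dist q) = ∑ m, O j m • e m := fun j =>
      (e.sum_repr _).symm
    have hO : ∀ j j', ∑ m, O j m * O j' m = if j = j' then 1 else 0 := by
      intro j j'
      rw [← hF j j', innerAt, hrepr j, hrepr j']
      simp only [map_sum, map_smul, LinearMap.sum_apply, LinearMap.smul_apply, hin, smul_eq_mul,
        mul_ite, mul_one, mul_zero, Finset.sum_ite_eq', Finset.mem_univ, if_true]
      exact Finset.sum_congr rfl fun m _ => mul_comm _ _
    -- These are the coordinates in the frame `E` of the tensor with coordinates `a` in the frame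
    -- `F`.
    refine ⟨WithLp.toLp 2 fun J => ∑ I, a I * ∏ l, O (I l) (J l), ?_, ?_⟩
    · rw [tensorMap_apply, hs]
      have h2 : ∀ I : Fin i → Fin k,
          nestedLie A.space.carrier i (fun l => A.component h 1 ((F (I l)).1 q)) =
          ∑ J : Fin i → Fin k, (∏ l, O (I l) (J l)) •
            nestedLie A.space.carrier i (fun l => A.component h 1 ((E (J l)).1 q)) := by
        intro I
        simp only [hFO, map_sum, map_smul]
        rw [MultilinearMap.map_sum]
        exact Finset.sum_congr rfl fun J _ => MultilinearMap.map_smul_univ _ _ _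
      simp only [h2, Finset.smul_sum, Finset.sum_smul, smul_smul]
      exact Finset.sum_comm
    · rw [EuclideanSpace.norm_sq_eq]
      simp only [Real.norm_eq_abs, sq_abs]
      exact (sum_sq_sum_mul_prod O hO a).symm
  · rintro ⟨a, ha, rfl⟩
    refine ⟨E, a, ho, ?_, ?_⟩
    · rw [A.sub_mem_flag_iff h hv, ← ha, tensorMap_apply]
    · rw [EuclideanSpace.norm_sq_eq]
      simp only [Real.norm_eq_abs, sq_abs]

end Frame


/-- Without such a basis `popp` takes its default value zero. In each weight, the surjection from
tensors gives vectors that are orthonormal for the quotient norm, and these replace the vectors of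
that weight in an adapted basis. -/
theorem exists_isPoppBasis (A : M.NilpotentApproximation q) :
    ∃ b : Module.Basis (Fin n) ℝ (TangentSpace (𝓡 n) q), M.IsPoppBasis q b := by
  obtain ⟨b, w, h⟩ := M.exists_isAdapted q
  obtain ⟨e, E, he, ho⟩ := M.exists_orthonormal_frame q
  have hE : ∀ X : M.horizontal, X.1 q ∈ Submodule.span ℝ (Set.range fun m => (E m).1 q) := by
    intro X
    have h1 := congrArg Subtype.val (e.sum_repr ⟨X.1 q, X.2.2 q⟩)
    rw [← show _ = X.1 q from h1, Submodule.coe_sum]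
    refine Submodule.sum_mem _ fun m _ => ?_
    rw [Submodule.coe_smul, ← he]
    exact Submodule.smul_mem _ _ (Submodule.subset_span ⟨m, rfl⟩)
  have himg : ∀ (W : Type) (c : Fin n → W) (i : ℕ),
      Set.range (fun j : {j // w j = i} => c j) = c '' {j | w j = i} := by
    intro W c i
    ext; simp
  have hu : ∀ i, ∃ u : {j // w j = i} → A.lieAlg,
      Submodule.span ℝ (Set.range u) = Submodule.span ℝ (A.lieBasis h '' {j | w j = i}) ∧
      ∀ t : {j // w j = i} → ℝ, sInf {s | ∃ a : EuclideanSpace ℝ (Fin i → Fin M.rank),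
        A.tensorMap h E i a = ∑ j, t j • u j ∧ s = ‖a‖ ^ 2} = ∑ j, t j ^ 2 := by
    intro i
    rw [← A.range_tensorMap h E hE i]
    refine exists_orthonormal_images (A.tensorMap h E i) ?_
    rw [A.range_tensorMap h E hE i, ← himg]
    exact finrank_span_eq_card ((A.lieBasis h).linearIndependent.comp _ Subtype.val_injective)
  choose u hus hun using hu
  -- On vectors of pure weight this isomorphism agrees with `component`, so its inverse brings the
  -- orthonormal vectors `u` back to `T_qM` and respects the blocks.
  let f : TangentSpace (𝓡 n) q ≃ₗ[ℝ] A.lieAlg := b.equiv (A.lieBasis h) (Equiv.refl _)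
  have hfb : ∀ j, f (b j) = A.lieBasis h j := fun j => by simp [f]
  let c : Fin n → TangentSpace (𝓡 n) q := fun j => f.symm (u (w j) ⟨j, rfl⟩)
  have hfc : ∀ i (j : {j // w j = i}), f (c j) = u i j := by
    rintro i ⟨j, rfl⟩
    exact f.apply_symm_apply _
  have hmap : ∀ (x : Fin n → TangentSpace (𝓡 n) q) (y : Fin n → A.lieAlg) (i : ℕ),
      (∀ j, w j = i → f (x j) = y j) →
      (Submodule.span ℝ (x '' {j | w j = i})).map f.toLinearMap =
        Submodule.span ℝ (y '' {j | w j = i}) := by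
    intro x y i hxy
    rw [Submodule.map_span, ← Set.image_comp]
    congr 1
    exact Set.image_congr fun j hj => hxy j hj
  have hspan : ∀ i, Submodule.span ℝ (c '' {j | w j = i}) =
      Submodule.span ℝ (b '' {j | w j = i}) := by
    intro i
    refine Submodule.map_injective_of_injective f.injective ?_
    rw [hmap b (A.lieBasis h) i fun j _ => hfb j, hmap c (fun j => f (c j)) i fun _ _ => rfl,
      ← hus i, ← himg]
    congr 2
    funext j
    exact hfc i j
  obtain ⟨b', hb', hA⟩ := (M.isAdapted_iff.1 h).exists_of_blocks c hspan
  have hA' : M.IsAdapted q b' w := M.isAdapted_iff.2 hA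
  refine ⟨b', w, hA', fun i t => ?_⟩
  have hcomp : ∀ v ∈ Submodule.span ℝ (b '' {j | w j = i}), A.component h i v = f v := by
    intro v hv
    induction hv using Submodule.span_induction with
    | mem x hx =>
      obtain ⟨j, rfl, rfl⟩ := hx
      rw [hfb, component, blockMap_basis, if_pos rfl]
    | zero => rw [map_zero, map_zero]
    | add x y _ _ hx hy => rw [map_add, map_add, hx, hy]
    | smul a x _ hx => rw [map_smul, map_smul, hx]
  have hsub : ∀ {W : Type} [AddCommMonoid W] (g : Fin n → W),
      ∑ j with w j = i, g j = ∑ j : {j // w j = i}, g j := fun g =>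
    Finset.sum_subtype _ (by simp) g
  have hsum : A.component h i (∑ j with w j = i, t j • b' j) =
      ∑ j : {j // w j = i}, t j • u i j := by
    rw [hcomp, map_sum, hsub]
    · refine Finset.sum_congr rfl fun j _ => ?_
      rw [map_smul, hb', hfc]
    · rw [← hspan, hb']
      exact Submodule.sum_mem _ fun j hj => Submodule.smul_mem _ _
        (Submodule.subset_span ⟨j, (Finset.mem_filter.1 hj).2, rfl⟩)
  rw [poppNormSq_eq, A.poppSet_eq h E he ho (hA'.sum_mem_flag i t), hsum, hun i, hsub]

end NilpotentApproximation

end OrientedStructure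

/-! ### Left translations are orientation-preserving isometries -/

theorem mfderiv_mul_left_mulInvariantVectorField {n : ℕ} {G : Type} [TopologicalSpace G]
    [ChartedSpace (EuclideanSpace ℝ (Fin n)) G] [Group G] [LieGroup (𝓡 n) ∞ G] (g x : G)
    (v : GroupLieAlgebra (𝓡 n) G) :
    mfderiv (𝓡 n) (𝓡 n) (g * ·) x (mulInvariantVectorField v x) =
      mulInvariantVectorField v (g * x) := by
  have hd : ∀ a y : G, MDifferentiableAt (𝓡 n) (𝓡 n) (a * ·) y := fun a y =>
    (contMDiff_mul_left (I := 𝓡 n) (n := ∞) (a := a)).mdifferentiableAt (by simp)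
  have h1 := mfderiv_comp (1 : G) (hd g (x * 1)) (hd x 1)
  have h2 : (g * ·) ∘ (x * ·) = (g * x * · : G → G) := funext fun y => (mul_assoc g x y).symm
  rw [h2] at h1
  have h3 : ∀ y : G, y = x →
      ((mfderiv (𝓡 n) (𝓡 n) (g * ·) y : EuclideanSpace ℝ (Fin n) →L[ℝ] EuclideanSpace ℝ (Fin n))
        (mulInvariantVectorField v x) : EuclideanSpace ℝ (Fin n)) =
      (mfderiv (𝓡 n) (𝓡 n) (g * ·) x : EuclideanSpace ℝ (Fin n) →L[ℝ] EuclideanSpace ℝ (Fin n))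
        (mulInvariantVectorField v x) := by
    rintro _ rfl
    rfl
  exact (h3 _ (mul_one x)).symm.trans (DFunLike.congr_fun h1 v).symm

namespace OrientedStructure

variable {n : ℕ} {M N : OrientedStructure n} {q : M.carrier} {p : N.carrier}

/-- A translation carries a left-invariant frame to itself, and the orientation form has constant
sign on that frame because the group is connected. -/
theorem preservesOrientation_leftTranslation (K : OrientedStructure n) [Group K.carrier]
    [LieGroup (𝓡 n) ∞ K.carrier] (g : K.carrier) :
    PreservesOrientation (M := K) (N := K) (leftTranslation (n := n) g) := by
  obtain ⟨μ, hμ, hμp⟩ := K.exists_orientation_form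
  refine preservesOrientation_of_form _ hμp fun x => ?_
  let β := tangentBasis (n := n) (1 : K.carrier)
  let f : K.carrier → ℝ := fun y => μ y fun j => mulInvariantVectorField (β j) y
  have hf : Continuous f :=
    (hμ _ fun j => smoothField_mulInvariantVectorField (β j)).continuous
  have h0 : ∀ y, f y ≠ 0 := fun y =>
    form_apply_basis_ne_zero (hμp y).ne_zero (β.map (mulInvariantEquiv y))
  have h1 : pullbackForm (M := K) (N := K) (leftTranslation (n := n) g) μ x
      (fun j => mulInvariantVectorField (β j) x) = f (g * x) := by
    refine congrArg (μ (g * x)) (funext fun j => ?_)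
    exact mfderiv_mul_left_mulInvariantVectorField g x (β j)
  have h2 : 0 < formRatio (pullbackForm (M := K) (N := K) (leftTranslation (n := n) g) μ) μ x := by
    rw [formRatio_apply (hμp x).ne_zero (h0 x), h1]
    have h3 := pos_mul_of_continuous hf h0 (g * x) x
    have h4 : f (g * x) / f x = f (g * x) * f x / (f x * f x) :=
      (mul_div_mul_right _ _ (h0 x)).symm
    change 0 < f (g * x) / f x
    rw [h4]
    exact div_pos h3 (mul_self_pos.2 (h0 x))
  rw [eq_formRatio_smul (pullbackForm (M := K) (N := K) (leftTranslation (n := n) g) μ)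
    (hμp x).ne_zero]
  exact (hμp x).smul h2

theorem NilpotentApproximation.isIsometry_leftTranslation (A : M.NilpotentApproximation q)
    (g : A.space.carrier) : IsIsometry A.space A.space (leftTranslation (n := n) g) := by
  have hd := fun (x : A.space.carrier) v =>
    mfderiv_mul_left_mulInvariantVectorField (n := n) g x v
  constructor
  · intro x
    refine Submodule.ext fun u => Iff.trans ?_ (A.dist_eq (g * x) u).symm
    constructor
    · rintro ⟨v, hv, rfl⟩
      obtain ⟨X, rfl⟩ := (A.dist_eq x v).1 hv
      exact ⟨X, hd x _⟩
    · rintro ⟨X, rfl⟩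
      exact ⟨_, (A.dist_eq x _).2 ⟨X, rfl⟩, hd x _⟩
  · intro x v w v' w' hv hw
    obtain ⟨X, hX⟩ := (A.dist_eq x v).1 v.2
    obtain ⟨Y, hY⟩ := (A.dist_eq x w).1 w.2
    rw [A.metric_eq x X Y v w hX hY]
    refine A.metric_eq (g * x) X Y v' w' ?_ ?_
    · rw [hv, hX]; exact hd x _
    · rw [hw, hY]; exact hd x _

/-! ### Orientations of nilpotent approximations -/

/-- A reversing isometry becomes orientation-preserving when either side is flipped. Both versions
are recorded, since the comparison with Popp's volume uses the two together. -/
theorem NilpotentIsometric.oriented_or (h : NilpotentIsometric M q N p) :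
    OrientedNilpotentIsometric M q N p ∨
      (OrientedNilpotentIsometric M.opposite q N p ∧
        OrientedNilpotentIsometric M q N.opposite p) := by
  obtain ⟨A, B, φ, hφ⟩ := h
  refine (preserves_or_reversesOrientation φ).imp (fun h1 => ⟨A, B, φ, hφ, h1⟩) fun h1 =>
    ⟨⟨A.opposite, B, φ, ⟨hφ.map_dist, hφ.map_metric⟩, h1⟩,
      ⟨A, B.opposite, φ, ⟨hφ.map_dist, hφ.map_metric⟩, fun β hβ x => ?_⟩⟩
  have h2 := h1 (fun y => -β y) (fun y => IsPositiveForm.neg_of_neg (hβ y)) x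
  have h3 : IsPositiveForm (- -A.space.orientation x) (pullbackForm φ β x) :=
    IsPositiveForm.of_neg_compLinearMap h2
  exact neg_neg (A.space.orientation x) ▸ h3

theorem PreservesOrientation.opposite {φ : M.carrier ≃ₘ^∞⟮𝓡 n, 𝓡 n⟯ N.carrier}
    (h : PreservesOrientation φ) :
    PreservesOrientation (M := M.opposite) (N := N.opposite) φ := fun β hβ x =>
  IsPositiveForm.of_neg_compLinearMap
    (h (fun y => -β y) (fun y => IsPositiveForm.neg_of_neg (hβ y)) x)

/-- The identity, which reverses the orientation. -/
def oppositeDiffeomorph (M : OrientedStructure n) :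
    M.opposite.carrier ≃ₘ^∞⟮𝓡 n, 𝓡 n⟯ M.carrier :=
  Diffeomorph.refl (𝓡 n) M.carrier ∞

theorem mfderiv_oppositeDiffeomorph (M : OrientedStructure n) (x : M.opposite.carrier)
    (v : TangentSpace (𝓡 n) x) : mfderiv (𝓡 n) (𝓡 n) M.oppositeDiffeomorph x v = v := by
  have h1 : ∀ y : M.carrier, mfderiv (𝓡 n) (𝓡 n) (id : M.carrier → M.carrier) y =
      ContinuousLinearMap.id ℝ (TangentSpace (𝓡 n) y) := fun y => mfderiv_id
  exact DFunLike.congr_fun (h1 x) v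

theorem isIsometry_oppositeDiffeomorph (M : OrientedStructure n) :
    IsIsometry M.opposite M M.oppositeDiffeomorph := by
  have h1 := M.mfderiv_oppositeDiffeomorph
  constructor
  · intro x
    ext u
    constructor
    · rintro ⟨v, hv, rfl⟩
      have h2 := h1 x v
      exact (congrArg (· ∈ M.dist x) h2).mpr hv
    · intro hu
      exact ⟨u, hu, h1 x u⟩
  · intro x v w v' w' hv hw
    have hv' : v' = v := Subtype.ext (hv.trans (h1 x v))
    have hw' : w' = w := Subtype.ext (hw.trans (h1 x w))
    rw [hv', hw']
    rfl

theorem pullbackForm_oppositeDiffeomorph (β : TopForm n M.carrier) :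
    pullbackForm M.oppositeDiffeomorph β = β := by
  funext x
  ext v
  exact congrArg (β x) (funext fun j => M.mfderiv_oppositeDiffeomorph x (v j))

theorem reversesOrientation_oppositeDiffeomorph (M : OrientedStructure n) :
    ReversesOrientation M.oppositeDiffeomorph := by
  intro β hβ x
  have h1 : ∀ y : M.carrier, IsPositiveForm (- -M.orientation y) (β y) := fun y =>
    (neg_neg (M.orientation y)).symm ▸ hβ y
  rw [pullbackForm_oppositeDiffeomorph]
  exact h1 x

/-! ### Popp's volume on bases -/

theorem IsPoppBasis.opposite {b : Module.Basis (Fin n) ℝ (TangentSpace (𝓡 n) q)}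
    (h : M.IsPoppBasis q b) : M.opposite.IsPoppBasis q b := by
  obtain ⟨w, hw, ht⟩ := h
  exact ⟨w, ⟨hw.mem, hw.span⟩, ht⟩

theorem IsPoppBasis.abs_form_eq {b b' : Module.Basis (Fin n) ℝ (TangentSpace (𝓡 n) q)}
    (h : M.IsPoppBasis q b) (h' : M.IsPoppBasis q b')
    (α : (TangentSpace (𝓡 n) q) [⋀^Fin n]→ₗ[ℝ] ℝ) :
    |α b'| = |α b| := by
  have h1 : α b' = α b * b.det b' := by
    conv_lhs => rw [α.eq_smul_basis_det b]
    rfl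
  rw [h1, abs_mul, h.abs_det_eq_one h', mul_one]

theorem exists_popp_eq (h : ∃ b, M.IsPoppBasis q b) :
    IsPositiveForm (M.orientation q) (M.popp q) ∧
      ∃ b, M.IsPoppBasis q b ∧ |M.popp q b| = 1 := by
  have h1 : h.choose.det ≠ 0 := h.choose.det_ne_zero
  rw [popp, dif_pos h]
  split_ifs with h2
  · refine ⟨h2, h.choose, h.choose_spec, ?_⟩
    rw [Module.Basis.det_self, abs_one]
  · refine ⟨(isPositiveForm_or_neg (finrank_tangentSpace q) _ h1).resolve_left h2,
      h.choose, h.choose_spec, ?_⟩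
    rw [AlternatingMap.neg_apply, Module.Basis.det_self, abs_neg, abs_one]

end OrientedStructure

/-! ### Intrinsic volumes -/

open OrientedStructure

namespace IntrinsicVolume

variable {n : ℕ} {M N : OrientedStructure n} {q : M.carrier} {p : N.carrier}

theorem form_ne_zero (vol : IntrinsicVolume n) (M : OrientedStructure n) (q : M.carrier) :
    vol.form M q ≠ 0 :=
  (vol.positive M q).ne_zero

/-- The density of an intrinsic volume with respect to another one. -/
def density (vol vol' : IntrinsicVolume n) (M : OrientedStructure n) : M.carrier → ℝ :=
  formRatio (vol.form M) (vol'.form M)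

variable {vol vol' : IntrinsicVolume n}

theorem contMDiff_density (M : OrientedStructure n) :
    ContMDiff (𝓡 n) 𝓘(ℝ) ∞ (density vol vol' M) :=
  M.contMDiff_formRatio (vol.smooth M) (vol'.smooth M) (vol'.form_ne_zero M)

theorem form_eq_density_smul (M : OrientedStructure n) (q : M.carrier) :
    vol.form M q = density vol vol' M q • vol'.form M q :=
  eq_formRatio_smul _ (vol'.form_ne_zero M q)

theorem density_eq_of_isometry {φ : M.carrier ≃ₘ^∞⟮𝓡 n, 𝓡 n⟯ N.carrier}
    (h : IsIsometry M N φ) (ho : PreservesOrientation φ) (x : M.carrier) :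
    density vol vol' M x = density vol vol' N (φ x) := by
  refine formRatio_eq_of_eq_smul (vol'.form_ne_zero M x) ?_
  rw [← vol.invariant M N φ h ho, ← vol'.invariant M N φ h ho, pullbackForm, pullbackForm,
    form_eq_density_smul (vol := vol) (vol' := vol') N (φ x)]
  rfl

/-- The two forms are pulled back by the same `liftMap`, which cancels in the ratio. -/
theorem density_eq_space (h : vol.IsNIntrinsic) (h' : vol'.IsNIntrinsic)
    (A : M.NilpotentApproximation q) : density vol vol' M q = density vol vol' A.space 1 := by
  obtain ⟨b, w, hb⟩ := M.exists_isAdapted q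
  refine formRatio_eq_of_eq_smul (vol'.form_ne_zero M q) ?_
  rw [h M q A b w hb, h' M q A b w hb, form_eq_density_smul (vol := vol) (vol' := vol') A.space 1]
  rfl

/-- Left translations act transitively by orientation-preserving isometries. -/
theorem density_space_eq (A : M.NilpotentApproximation q) (x : A.space.carrier) :
    density vol vol' A.space x = density vol vol' A.space 1 := by
  have h1 := density_eq_of_isometry (vol := vol) (vol' := vol')
    (A.isIsometry_leftTranslation x⁻¹) (preservesOrientation_leftTranslation A.space x⁻¹) x
  rw [h1, coe_leftTranslation]
  exact congrArg _ (inv_mul_cancel x)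

/-- The isometry need not send unit to unit; homogeneity of the target absorbs the difference. -/
theorem density_eq_of_orientedNilpotentIsometric (h : vol.IsNIntrinsic) (h' : vol'.IsNIntrinsic)
    (hi : M.OrientedNilpotentIsometric q N p) :
    density vol vol' M q = density vol vol' N p := by
  obtain ⟨A, B, φ, hφ, ho⟩ := hi
  rw [density_eq_space h h' A, density_eq_of_isometry hφ ho, density_space_eq B,
    density_eq_space h h' B]

/-- The identity is an orientation-reversing isometry from the opposite structure. -/
theorem OrientationIndependent.form_opposite (h : vol.OrientationIndependent)
    (M : OrientedStructure n) (q : M.carrier) : vol.form M.opposite q = -vol.form M q := by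
  have h1 := h M.opposite M _ M.isIsometry_oppositeDiffeomorph
    M.reversesOrientation_oppositeDiffeomorph
  have h2 : vol.form M q = -vol.form M.opposite q :=
    congrFun ((pullbackForm_oppositeDiffeomorph (vol.form M)).symm.trans h1) q
  exact neg_eq_iff_eq_neg.1 h2.symm

theorem density_opposite (h : vol.OrientationIndependent) (h' : vol'.OrientationIndependent)
    (M : OrientedStructure n) (q : M.carrier) :
    density vol vol' M.opposite q = density vol vol' M q := by
  refine formRatio_eq_of_eq_smul (M := M.opposite.carrier) (vol'.form_ne_zero M.opposite q) ?_
  have h1 := form_eq_density_smul (vol := vol) (vol' := vol') M q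
  have h2 : vol.form M.opposite q = -(density vol vol' M q • vol'.form M q) :=
    (h.form_opposite M q).trans (congrArg Neg.neg h1)
  exact h2.trans ((smul_neg _ _).symm.trans
    (congrArg (density vol vol' M q • ·) (h'.form_opposite M q).symm))

theorem density_eq_of_nilpotentIsometric (h : vol.IsNIntrinsic) (h' : vol'.IsNIntrinsic)
    (ho : vol.OrientationIndependent) (ho' : vol'.OrientationIndependent)
    (hi : M.NilpotentIsometric q N p) : density vol vol' M q = density vol vol' N p := by
  rcases hi.oriented_or with h1 | ⟨h1, -⟩
  · exact density_eq_of_orientedNilpotentIsometric h h' h1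
  · exact (density_opposite ho ho' M q).symm.trans
      (density_eq_of_orientedNilpotentIsometric h h' h1)

/-- On an equi-nilpotentizable structure the density of an N-intrinsic volume with respect to
another one takes at most two values, so it is constant. -/
theorem density_eq_of_equiNilpotentizable (h : vol.IsNIntrinsic) (h' : vol'.IsNIntrinsic)
    (he : M.EquiNilpotentizable) (p q : M.carrier) :
    density vol vol' M p = density vol vol' M q := by
  -- An orientation-preserving isometry to the approximation at `p` gives the first value, a
  -- reversing one the second.
  have h1 : (density vol vol' M '' Set.univ) ⊆
      {density vol vol' M p, density vol vol' M.opposite p} := by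
    rintro _ ⟨x, -, rfl⟩
    rcases (he x p).oriented_or with h2 | ⟨-, h2⟩
    · exact Or.inl (density_eq_of_orientedNilpotentIsometric h h' h2)
    · exact Or.inr (density_eq_of_orientedNilpotentIsometric h h' h2)
  -- The image is connected and lies in a finite, hence totally disconnected, set.
  have h2 : (density vol vol' M '' Set.univ).Subsingleton :=
    ((Set.toFinite _).subset h1).countable.isTotallyDisconnected _ subset_rfl
      (isPreconnected_univ.image _ (contMDiff_density M).continuous.continuousOn)
  exact h2 ⟨p, trivial, rfl⟩ ⟨q, trivial, rfl⟩

theorem exists_form_eq_smul_form (h : vol.IsNIntrinsic) (h' : vol'.IsNIntrinsic)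
    (he : M.EquiNilpotentizable) : ∃ a : ℝ, ∀ q, vol.form M q = a • vol'.form M q := by
  obtain ⟨p⟩ := (inferInstance : Nonempty M.carrier)
  exact ⟨density vol vol' M p, fun q => by
    rw [density_eq_of_equiNilpotentizable h h' he p q]
    exact form_eq_density_smul M q⟩

/-- The intrinsic volume that measures a structure with its opposite orientation. -/
def opposite (vol : IntrinsicVolume n) : IntrinsicVolume n where
  form M := fun q => -vol.form M.opposite q
  smooth M := fun X hX => (vol.smooth M.opposite X hX).neg
  positive M q := IsPositiveForm.neg_of_neg (vol.positive M.opposite q)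
  invariant M N φ h ho := by
    have h1 := vol.invariant M.opposite N.opposite φ ⟨h.map_dist, h.map_metric⟩ ho.opposite
    rw [← h1]
    rfl

theorem IsNIntrinsic.opposite (h : vol.IsNIntrinsic) : vol.opposite.IsNIntrinsic := by
  intro M q A b w hb
  have h1 := h M.opposite q A.opposite b w ⟨hb.mem, hb.span⟩
  exact congrArg Neg.neg h1

/-! ### Comparison with Popp's volume -/

/-- A Popp basis of `T_qM` is carried by `liftMap` to a Popp basis of the Lie algebra, and
N-intrinsicality says that the volume takes the same value on both. -/
theorem abs_form_eq_space (h : vol.IsNIntrinsic) (A : M.NilpotentApproximation q)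
    {b : Module.Basis (Fin n) ℝ (TangentSpace (𝓡 n) q)} (hb : M.IsPoppBasis q b)
    {b' : Module.Basis (Fin n) ℝ (TangentSpace (𝓡 n) (1 : A.space.carrier))}
    (hb' : A.space.IsPoppBasis 1 b') : |vol.form M q b| = |vol.form A.space 1 b'| := by
  obtain ⟨w, hw, ht⟩ := hb
  rw [(A.isPoppBasis_lieBasis hw ht).abs_form_eq hb', h M q A b w hw]
  exact congrArg (fun v => |vol.form A.space 1 v|) (funext fun j => (A.lieBasis_apply hw j).symm)

theorem abs_form_eq_of_isometry {φ : M.carrier ≃ₘ^∞⟮𝓡 n, 𝓡 n⟯ N.carrier}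
    (h : IsIsometry M N φ) (ho : PreservesOrientation φ) {x : M.carrier} {y : N.carrier}
    (hxy : φ x = y) {b : Module.Basis (Fin n) ℝ (TangentSpace (𝓡 n) x)} (hb : M.IsPoppBasis x b)
    {b' : Module.Basis (Fin n) ℝ (TangentSpace (𝓡 n) y)} (hb' : N.IsPoppBasis y b') :
    |vol.form M x b| = |vol.form N y b'| := by
  subst hxy
  rw [(h.isPoppBasis hb).abs_form_eq hb', ← vol.invariant M N φ h ho]
  rfl

theorem abs_form_eq_of_orientedNilpotentIsometric (h : vol.IsNIntrinsic)
    (hi : M.OrientedNilpotentIsometric q N p)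
    {b : Module.Basis (Fin n) ℝ (TangentSpace (𝓡 n) q)} (hb : M.IsPoppBasis q b)
    {b' : Module.Basis (Fin n) ℝ (TangentSpace (𝓡 n) p)} (hb' : N.IsPoppBasis p b') :
    |vol.form M q b| = |vol.form N p b'| := by
  obtain ⟨A, B, φ, hφ, ho⟩ := hi
  have hA : ∃ b₁, A.space.IsPoppBasis 1 b₁ := by
    obtain ⟨w, hw, ht⟩ := hb
    exact ⟨_, A.isPoppBasis_lieBasis hw ht⟩
  have hB : ∃ b₁, B.space.IsPoppBasis 1 b₁ := by
    obtain ⟨w, hw, ht⟩ := hb'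
    exact ⟨_, B.isPoppBasis_lieBasis hw ht⟩
  obtain ⟨bA, hbA⟩ := hA
  obtain ⟨bB, hbB⟩ := hB
  rw [abs_form_eq_space h A hb hbA, abs_form_eq_space h B hb' hbB,
    abs_form_eq_of_isometry hφ ho rfl hbA (hφ.isPoppBasis hbA)]
  exact abs_form_eq_of_isometry (B.isIsometry_leftTranslation (φ 1)⁻¹)
    (preservesOrientation_leftTranslation B.space _) (inv_mul_cancel (φ 1))
    (hφ.isPoppBasis hbA) hbB

/-- A reversing isometry only relates the volume of `M` at one point to that of the opposite
structure at the other. Two such crossed equalities, together with a constant ratio between the two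
volumes, force that ratio to be `±1`. -/
theorem abs_form_eq_of_equiNilpotentizable (h : vol.IsNIntrinsic) (he : M.EquiNilpotentizable)
    {p q : M.carrier} {b : Module.Basis (Fin n) ℝ (TangentSpace (𝓡 n) q)}
    (hb : M.IsPoppBasis q b) {b' : Module.Basis (Fin n) ℝ (TangentSpace (𝓡 n) p)}
    (hb' : M.IsPoppBasis p b') : |vol.form M q b| = |vol.form M p b'| := by
  rcases (he q p).oriented_or with h1 | ⟨h1, h2⟩
  · exact abs_form_eq_of_orientedNilpotentIsometric h h1 hb hb'
  · obtain ⟨a, ha⟩ := exists_form_eq_smul_form h h.opposite he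
    have ha' : ∀ (x : M.carrier) (v : Fin n → TangentSpace (𝓡 n) x),
        |vol.form M x v| = |a| * |vol.form M.opposite x v| := by
      intro x v
      rw [ha x, AlternatingMap.smul_apply, smul_eq_mul, abs_mul]
      exact congrArg _ (abs_neg _)
    have h3 : |vol.form M.opposite q b| = |vol.form M p b'| :=
      abs_form_eq_of_orientedNilpotentIsometric (M := M.opposite) h h1 hb.opposite hb'
    have h4 : |vol.form M q b| = |vol.form M.opposite p b'| :=
      abs_form_eq_of_orientedNilpotentIsometric (N := M.opposite) h h2 hb hb'.opposite
    have h5 := ha' q b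
    have h6 := ha' p b'
    rw [h3] at h5
    rw [← h4] at h6
    have hpos : 0 < |vol.form M q b| :=
      abs_pos.2 (form_apply_basis_ne_zero (vol.form_ne_zero M q) b)
    -- Crossing from `q` to `p` and back multiplies a nonzero number by `|a|` twice.
    have h7 : |a| * |a| = 1 := by
      rw [h6, ← mul_assoc] at h5
      exact mul_right_cancel₀ hpos.ne' (h5.symm.trans (one_mul _).symm)
    have h8 : |a| = 1 := by nlinarith [abs_nonneg a]
    rw [h5, h8, one_mul]

theorem exists_form_eq_smul_popp (h : vol.IsNIntrinsic) (he : M.EquiNilpotentizable) :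
    ∃ a : ℝ, ∀ q, vol.form M q = a • M.popp q := by
  have hex : ∀ q, ∃ b, M.IsPoppBasis q b := fun q => by
    obtain ⟨A, -⟩ := he q q
    exact A.exists_isPoppBasis
  obtain ⟨p⟩ := (inferInstance : Nonempty M.carrier)
  obtain ⟨b', hb'⟩ := hex p
  -- Popp's form is `±1` on some Popp basis at each point, so the constant is the absolute value of
  -- the volume on any Popp basis.
  refine ⟨|vol.form M p b'|, fun q => ?_⟩
  obtain ⟨hpos, b, hb, h1⟩ := exists_popp_eq (hex q)
  obtain ⟨r, hr, hrr⟩ := (vol.positive M q).exists_eq_smul hpos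
  have h2 := abs_form_eq_of_equiNilpotentizable h he hb hb'
  rw [← h2, hrr, AlternatingMap.smul_apply, smul_eq_mul, abs_mul, h1, mul_one, abs_of_pos hr]

end IntrinsicVolume

end

theorem theoremt (n : ℕ) (vol vol' : IntrinsicVolume n)
    (h : vol.IsNIntrinsic) (h' : vol'.IsNIntrinsic) :
    ∃ c : ∀ M : OrientedStructure n, M.carrier → ℝ,
      (∀ M : OrientedStructure n, ContMDiff (𝓡 n) 𝓘(ℝ) ∞ (c M) ∧
        ∀ q, vol.form M q = c M q • vol'.form M q) ∧
      (∀ (M N : OrientedStructure n) (q : M.carrier) (p : N.carrier),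
        M.OrientedNilpotentIsometric q N p → c M q = c N p) ∧
      (vol.OrientationIndependent → vol'.OrientationIndependent →
        ∀ (M N : OrientedStructure n) (q : M.carrier) (p : N.carrier),
          M.NilpotentIsometric q N p → c M q = c N p) ∧
      (∀ M : OrientedStructure n, M.EquiNilpotentizable →
        (∃ a : ℝ, ∀ q, vol.form M q = a • vol'.form M q) ∧
        (∃ a : ℝ, ∀ q, vol.form M q = a • M.popp q)) := by
  exact ⟨IntrinsicVolume.density vol vol',
    fun M => ⟨IntrinsicVolume.contMDiff_density M, IntrinsicVolume.form_eq_density_smul M⟩,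
    fun _ _ _ _ hi => IntrinsicVolume.density_eq_of_orientedNilpotentIsometric h h' hi,
    fun ho ho' _ _ _ _ hi => IntrinsicVolume.density_eq_of_nilpotentIsometric h h' ho ho' hi,
    fun _ he => ⟨IntrinsicVolume.exists_form_eq_smul_form h h' he,
      IntrinsicVolume.exists_form_eq_smul_popp h he⟩⟩
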